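/- **Lemma 3.7.** Let $\mathcal T$ be a finite tree with $p\ge 2$ vertices and root $v_0$ (any vertex), with all $g=p-1$ edges directed away from the root. Let $A$ be its adjacency matrix and $D$ the diagonal matrix of the degrees $d(v)$. Let $\widehat A,\widehat D$ be $A,D$ with the row and the column of $v_0$ deleted, and put $$\psi(z)=\det(-zD+A),\qquad \widehat\psi(z)=\det(-z\widehat D+\widehat A).$$ Identify every edge $e$ with $[0,\ell]$, $\ell>0$, where $0$ is its initial vertex, and let $q_e\in L^2(0,\ell)$ be arbitrary real potentials. For $\lambda\in\mathbb C$ let $c_e,s_e$ be the solutions of $-y''+q_ey=\lambda y$ on $[0,\ell]$ with $c_e(0)=1$, $c_e'(0)=0$, $s_e(0)=0$, $s_e'(0)=1$. Substitute $y_e=a_ec_e+b_es_e$ into the following vertex conditions. At a vertex $v\ne v_0$ with incoming edge $e$: $y_e(\ell)-y_k(0)=0$ for each edge $k$ outgoing from $v$, and $y_e'(\ell)-\sum_k y_k'(0)=0$, the sum being over the edges $k$ outgoing from $v$ (standard conditions). At the root: in Problem D, $y_k(0)=0$ for each edge $k$ at $v_0$; in Problem N, with a fixed edge $e_1$ at $v_0$,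 $y_{e_1}(0)-y_k(0)=0$ for the other edges $k$ at $v_0$, and $\sum_k y_k'(0)=0$, the sum being over all edges $k$ at $v_0$. For each of the two problems this is a system of $2g$ linear equations in the $2g$ unknowns $a_e,b_e$. List the equations of each problem, and the unknowns, in an arbitrary order, let $\Phi_D(\lambda),\Phi_N(\lambda)$ be the $2g\times 2g$ matrices of the two systems, and let $\phi_D=\det\Phi_D$, $\phi_N=\det\Phi_N$. The order fixes the sign of the determinant, as follows. Pair the equation $y_e'(\ell)-\sum_k y_k'(0)=0$ with the unknown $b_e$. Pair the equation in which $y_k(0)$ enters as the value at the initial vertex of the edge $k$ (that is, $y_e(\ell)-y_k(0)=0$ at a vertex other than the root; $y_k(0)=0$ at the root in Problem D; $y_{e_1}(0)-y_k(0)=0$ with $k\neq e_1$ at the root in Problem N) with the unknown $a_k$. In Problem N pair the equation $\sum_k y_k'(0)=0$ at the root with $a_{e_1}$. Let $\sigma_D,\sigma_N\in\{1,-1\}$ be the sign of the permutation that carries the chosen order of the equations of the respective problem, under this pairing, to the chosen order of the unknowns (so it is $1$ if paired equations and unknowns are listed in the same order), and let $$\varepsilon_N=-\sigma_N,\qquad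 \varepsilon_D=(-1)^{d(v_0)}\sigma_D .$$ Then, as $\lambda\to+\infty$ along the positive reals, $$\phi_N(\lambda)=\varepsilon_N\,\frac{\sqrt\lambda}{\sin(\sqrt\lambda\,\ell)}\,\psi\big(\cos(\sqrt\lambda\,\ell)\big)+O(1),\qquad \phi_D(\lambda)=\varepsilon_D\,\widehat\psi\big(\cos(\sqrt\lambda\,\ell)\big)+O\big(1/\sqrt\lambda\big).$$ Here the quotient in the first formula has a removable singularity, with limit $0$, at each $\lambda>0$ with $\sin(\sqrt\lambda\,\ell)=0$, and it is given the value $0$ there. -/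

import Mathlib

open MeasureTheory Set Asymptotics

/-! ## Solutions of the Sturm-Liouville equation on one edge -/

/-- `y`, with derivative `dy`, solves `-y'' + q y = lam y` on `[0, ℓ]` with `y(0) = a` and
`y'(0) = b`, in the sense of Carathéodory: `y` is continuously differentiable, `y'` is absolutely
continuous, and the equation holds almost everywhere. This is written in integrated form: `y` is
the primitive of `dy`, and `dy` is the primitive of `(q - lam) y`. -/
structure IsSLSolution (ℓ : ℝ) (q : ℝ → ℝ) (lam a b : ℂ) (y dy : ℝ → ℂ) : Prop where
  continuousOn : ContinuousOn y (Icc 0 ℓ)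
  continuousOn_deriv : ContinuousOn dy (Icc 0 ℓ)
  eq : ∀ x ∈ Icc 0 ℓ, y x = a + ∫ t in (0 : ℝ)..x, dy t
  eq_deriv : ∀ x ∈ Icc 0 ℓ, dy x = b + ∫ t in (0 : ℝ)..x, ((q t : ℂ) - lam) * y t

theorem volterra_kernel_le {m : ℝ → ℝ} (hm : Integrable m) (hm2 : Integrable fun t => m t ^ 2) :
    ∃ K : ℝ, ∀ x : ℝ, 0 ≤ x → ∫ t in (0 : ℝ)..x, Real.exp (-(K * (x - t))) * m t ≤ 1 / 2 := by
  set C := ∫ t, m t ^ 2 with hC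
  have hC0 : 0 ≤ C := integral_nonneg fun t => sq_nonneg _
  refine ⟨2 * (C + 1), fun x hx => ?_⟩
  set K := 2 * (C + 1) with hK
  have hK0 : 0 < K := by positivity
  have hexp : Continuous fun t : ℝ => Real.exp (-(K * (x - t))) := by fun_prop
  have hexp2 : Continuous fun t : ℝ => K / 2 * Real.exp (-(2 * K * (x - t))) := by fun_prop
  have h1 : ∫ t in (0 : ℝ)..x, Real.exp (-(K * (x - t))) * m t ≤
      ∫ t in (0 : ℝ)..x, (1 / (2 * K) * m t ^ 2 + K / 2 * Real.exp (-(2 * K * (x - t)))) := by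
    apply intervalIntegral.integral_mono_on hx
    · exact (hm.intervalIntegrable).continuousOn_mul hexp.continuousOn
    · exact ((hm2.const_mul _).intervalIntegrable).add (hexp2.intervalIntegrable _ _)
    · intro t _
      have : Real.exp (-(2 * K * (x - t))) = Real.exp (-(K * (x - t))) ^ 2 := by
        rw [← Real.exp_nat_mul]; congr 1; push_cast; ring
      rw [this]
      have h2 : 0 ≤ 1 / (2 * K) * (m t - K * Real.exp (-(K * (x - t)))) ^ 2 := by positivity
      have h3 : 1 / (2 * K) * (m t - K * Real.exp (-(K * (x - t)))) ^ 2 =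
        (1 / (2 * K) * m t ^ 2 + K / 2 * Real.exp (-(K * (x - t))) ^ 2)
          - Real.exp (-(K * (x - t))) * m t := by field_simp; ring
      linarith
  have h2 : ∫ t in (0 : ℝ)..x, K / 2 * Real.exp (-(2 * K * (x - t))) ≤ 1 / 4 := by
    have : ∀ t ∈ uIcc 0 x, HasDerivAt (fun t => 1 / 4 * Real.exp (-(2 * K * (x - t))))
        (K / 2 * Real.exp (-(2 * K * (x - t)))) t := by
      intro t _
      have h := ((((hasDerivAt_id t).const_sub x).const_mul (2 * K)).neg.exp).const_mul (1 / 4 : ℝ)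
      exact h.congr_deriv (by simp only [Pi.neg_apply, id]; ring)
    rw [intervalIntegral.integral_eq_sub_of_hasDerivAt this (hexp2.intervalIntegrable _ _)]
    have := Real.exp_pos (-(2 * K * (x - 0)))
    simp only [sub_self, mul_zero, neg_zero, Real.exp_zero]
    linarith
  have h3 : ∫ t in (0 : ℝ)..x, 1 / (2 * K) * m t ^ 2 ≤ 1 / 4 := by
    rw [intervalIntegral.integral_const_mul, intervalIntegral.integral_of_le hx]
    have : ∫ t in Ioc 0 x, m t ^ 2 ≤ C :=
      setIntegral_le_integral hm2 (Filter.Eventually.of_forall fun t => sq_nonneg _)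
    calc _ ≤ 1 / (2 * K) * C := by gcongr
      _ ≤ 1 / 4 := by rw [hK]; field_simp; linarith
  rw [intervalIntegral.integral_add ((hm2.const_mul _).intervalIntegrable)
    (hexp2.intervalIntegrable _ _)] at h1
  linarith

/-- For a square integrable potential the initial value problem has a solution. -/
theorem exists_isSLSolution {ℓ : ℝ} (hℓ : 0 < ℓ) {q : ℝ → ℝ}
    (hq : MemLp q 2 (volume.restrict (Ioo 0 ℓ))) (lam a b : ℂ) :
    ∃ u : (ℝ → ℂ) × (ℝ → ℂ), IsSLSolution ℓ q lam a b u.1 u.2 := by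
  -- the coefficient, cut off outside the edge
  set Q : ℝ → ℂ := (Ioo 0 ℓ).indicator fun t => (q t : ℂ) - lam with hQ
  have hQ2 : MemLp Q 2 := by
    rw [hQ, memLp_indicator_iff_restrict measurableSet_Ioo]
    exact hq.ofReal.sub (memLp_const lam)
  have hQ1 : Integrable Q := by
    rw [hQ, integrable_indicator_iff measurableSet_Ioo]
    exact (hq.ofReal.sub (memLp_const lam)).integrable (by norm_num)
  set m : ℝ → ℝ := fun t => (Ioo 0 ℓ).indicator (fun _ => 1) t + ‖Q t‖ with hm
  have hi2 : MemLp ((Ioo 0 ℓ).indicator (fun _ => (1 : ℝ))) 2 := by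
    rw [memLp_indicator_iff_restrict measurableSet_Ioo]; exact memLp_const _
  have hi1 : Integrable ((Ioo 0 ℓ).indicator (fun _ => (1 : ℝ))) := by
    rw [integrable_indicator_iff measurableSet_Ioo]; exact integrable_const _
  have hm1 : Integrable m := hi1.add hQ1.norm
  have hm2 : Integrable fun t => m t ^ 2 := (hi2.add hQ2.norm).integrable_sq
  obtain ⟨K, hK⟩ := volterra_kernel_le hm1 hm2
  have h0 : (0 : ℝ) ∈ Icc 0 ℓ := ⟨le_rfl, hℓ.le⟩
  let ext : C(Icc (0 : ℝ) ℓ, ℂ × ℂ) → ℝ → ℂ × ℂ := fun z => IccExtend hℓ.le z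
  have hext : ∀ z, Continuous (ext z) := fun z => z.continuous.Icc_extend'
  let J : ℝ → ℂ := (Ioo 0 ℓ).indicator fun _ => 1
  have hJ1 : Integrable J := by
    rw [integrable_indicator_iff measurableSet_Ioo]; exact integrable_const _
  let f : C(Icc (0 : ℝ) ℓ, ℂ × ℂ) → ℝ → ℂ × ℂ := fun z t =>
    Real.exp (K * t) • (J t * (ext z t).2, Q t * (ext z t).1)
  have hf : ∀ z s t, IntervalIntegrable (f z) volume s t := by
    intro z s t
    have hc : Continuous fun t : ℝ => Real.exp (K * t) := by fun_prop
    have e1 : IntervalIntegrable (fun t => J t * (ext z t).2) volume s t :=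
      hJ1.intervalIntegrable.mul_continuousOn (hext z).snd.continuousOn
    have e2 : IntervalIntegrable (fun t => Q t * (ext z t).1) volume s t :=
      hQ1.intervalIntegrable.mul_continuousOn (hext z).fst.continuousOn
    have e3 : IntervalIntegrable (fun t => (J t * (ext z t).2, Q t * (ext z t).1)) volume s t :=
      ⟨e1.1.prodMk e2.1, e1.2.prodMk e2.2⟩
    exact e3.continuousOn_smul hc.continuousOn
  let T : C(Icc (0 : ℝ) ℓ, ℂ × ℂ) → C(Icc (0 : ℝ) ℓ, ℂ × ℂ) := fun z =>
    ⟨fun x => Real.exp (-(K * x)) • ((a, b) + ∫ t in (0 : ℝ)..x, f z t), by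
      have := (intervalIntegral.continuous_primitive (hf z) 0).comp
        (continuous_subtype_val (p := (· ∈ Icc 0 ℓ)))
      have hc : Continuous fun t : Icc (0 : ℝ) ℓ => Real.exp (-(K * t)) := by fun_prop
      exact hc.smul (continuous_const.add this)⟩
  have hT : ContractingWith (1 / 2) T := by
    refine ⟨by rw [← NNReal.coe_lt_coe]; norm_num, LipschitzWith.of_dist_le_mul fun z w => ?_⟩
    rw [ContinuousMap.dist_le (by positivity)]
    intro x
    have hx := x.2.1
    have e1 : T z x - T w x =
        ∫ t in (0 : ℝ)..x, Real.exp (-(K * x)) • (f z t - f w t) := by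
      rw [intervalIntegral.integral_smul, intervalIntegral.integral_sub (hf z _ _) (hf w _ _)]
      simp only [T, ContinuousMap.coe_mk]
      rw [← smul_sub]; congr 1; abel
    rw [dist_eq_norm, e1]
    have e2 : ∀ t, ‖Real.exp (-(K * x)) • (f z t - f w t)‖ ≤
        Real.exp (-(K * (x - t))) * m t * dist z w := by
      intro t
      have e3 : Real.exp (-(K * (x - t))) = Real.exp (-(K * x)) * Real.exp (K * t) := by
        rw [← Real.exp_add]; congr 1; ring
      have e4 : ‖ext z t - ext w t‖ ≤ dist z w := by
        rw [← dist_eq_norm]; exact ContinuousMap.dist_apply_le_dist _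
      have e5 : f z t - f w t = Real.exp (K * t) •
          (J t * (ext z t - ext w t).2, Q t * (ext z t - ext w t).1) := by
        simp only [f, ← smul_sub, Prod.mk_sub_mk, Prod.fst_sub, Prod.snd_sub, mul_sub]
      have hJm : ‖J t‖ ≤ m t := by
        simp only [J, hm, indicator]; split_ifs <;> simp
      have hQm : ‖Q t‖ ≤ m t := by
        simp only [hm, indicator]; split_ifs <;> simp
      have hm0 : 0 ≤ m t := (norm_nonneg _).trans hJm
      rw [e5, norm_smul, norm_smul, e3, Real.norm_of_nonneg (Real.exp_pos _).le,
        Real.norm_of_nonneg (Real.exp_pos _).le, mul_assoc (_ * _), mul_assoc]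
      gcongr
      rw [Prod.norm_mk, max_le_iff, norm_mul, norm_mul]
      exact ⟨mul_le_mul hJm ((norm_snd_le _).trans e4) (norm_nonneg _) hm0,
        mul_le_mul hQm ((norm_fst_le _).trans e4) (norm_nonneg _) hm0⟩
    have hc : Continuous fun t : ℝ => Real.exp (-(K * (x - t))) := by fun_prop
    have e6 := intervalIntegral.norm_integral_le_of_norm_le hx
      (Filter.Eventually.of_forall fun t _ => e2 t)
      ((hm1.intervalIntegrable.continuousOn_mul hc.continuousOn).mul_const _)
    rw [intervalIntegral.integral_mul_const] at e6
    refine e6.trans ?_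
    have := hK x hx
    push_cast
    gcongr
  set z := ContractingWith.fixedPoint T hT
  have hz : T z = z := hT.fixedPoint_isFixedPt
  let u : ℝ → ℂ × ℂ := fun x => Real.exp (K * x) • ext z x
  have hu : Continuous u := by
    have hc : Continuous fun t : ℝ => Real.exp (K * t) := by fun_prop
    exact hc.smul (hext z)
  have hux : ∀ x ∈ Icc 0 ℓ, u x = (a, b) + ∫ t in (0 : ℝ)..x, (J t * (u t).2, Q t * (u t).1) := by
    intro x hx
    have e1 : ext z x = T z ⟨x, hx⟩ := by rw [hz]; exact IccExtend_of_mem _ _ hx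
    have e2 : ∀ t, (J t * (u t).2, Q t * (u t).1) = f z t := by
      intro t
      simp only [u, f, Prod.smul_snd, Prod.smul_fst, Prod.smul_mk, mul_smul_comm]
    simp only [e2]
    simp only [u, e1, T, ContinuousMap.coe_mk]
    rw [smul_smul, ← Real.exp_add, add_neg_cancel, Real.exp_zero, one_smul]
  have hi : ∀ x, IntervalIntegrable (fun t => (J t * (u t).2)) volume 0 x :=
    fun x => hJ1.intervalIntegrable.mul_continuousOn hu.snd.continuousOn
  have hi' : ∀ x, IntervalIntegrable (fun t => (Q t * (u t).1)) volume 0 x :=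
    fun x => hQ1.intervalIntegrable.mul_continuousOn hu.fst.continuousOn
  have hae : ∀ x ∈ Icc 0 ℓ, ∀ᵐ t, t ∈ uIoc 0 x → t ∈ Ioo 0 ℓ := by
    intro x hx
    have : ∀ᵐ t : ℝ, t ≠ ℓ := by simp [ae_iff, measure_singleton]
    filter_upwards [this] with t ht h
    rw [uIoc_of_le hx.1] at h
    exact ⟨h.1, lt_of_le_of_ne (h.2.trans hx.2) ht⟩
  refine ⟨(fun x => (u x).1, fun x => (u x).2), hu.fst.continuousOn, hu.snd.continuousOn, ?_, ?_⟩
  · intro x hx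
    have e := congrArg Prod.fst (hux x hx)
    rw [Prod.fst_add, intervalIntegral.integral_of_le hx.1,
      fst_integral (((hi x).1).prodMk ((hi' x).1)), ← intervalIntegral.integral_of_le hx.1] at e
    simp only at e ⊢
    rw [e]
    congr 1
    apply intervalIntegral.integral_congr_ae
    filter_upwards [hae x hx] with t ht h
    simp [J, ht h]
  · intro x hx
    have e := congrArg Prod.snd (hux x hx)
    rw [Prod.snd_add, intervalIntegral.integral_of_le hx.1,
      snd_integral (((hi x).1).prodMk ((hi' x).1)), ← intervalIntegral.integral_of_le hx.1] at e
    simp only at e ⊢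
    rw [e]
    congr 1
    apply intervalIntegral.integral_congr_ae
    filter_upwards [hae x hx] with t ht h
    simp [hQ, ht h]

/-- The pair `(y, y')`, where `y` is the solution on `[0, ℓ]` of `-y'' + q y = lam y`, `y(0) = a`,
`y'(0) = b`. It exists by `exists_isSLSolution`, and it is unique on `[0, ℓ]`; only its value at
the end point `ℓ` is used below. -/
noncomputable def slSolution (ℓ : ℝ) (q : ℝ → ℝ) (lam a b : ℂ) : (ℝ → ℂ) × (ℝ → ℂ) :=
  Classical.epsilon fun u => IsSLSolution ℓ q lam a b u.1 u.2

/-- `c(√lam, ℓ)`, for the solution with `c(0) = 1`, `c'(0) = 0`. -/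
noncomputable def cEnd (ℓ : ℝ) (q : ℝ → ℝ) (lam : ℂ) : ℂ := (slSolution ℓ q lam 1 0).1 ℓ

/-- `c'(√lam, ℓ)`. -/
noncomputable def cDerivEnd (ℓ : ℝ) (q : ℝ → ℝ) (lam : ℂ) : ℂ := (slSolution ℓ q lam 1 0).2 ℓ

/-- `s(√lam, ℓ)`, for the solution with `s(0) = 0`, `s'(0) = 1`. -/
noncomputable def sEnd (ℓ : ℝ) (q : ℝ → ℝ) (lam : ℂ) : ℂ := (slSolution ℓ q lam 0 1).1 ℓ

/-- `s'(√lam, ℓ)`. -/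
noncomputable def sDerivEnd (ℓ : ℝ) (q : ℝ → ℝ) (lam : ℂ) : ℂ := (slSolution ℓ q lam 0 1).2 ℓ

/-! ## The rooted tree, its determinants, and the characteristic matrices -/

namespace RootedTree

/-- In a tree with root `v₀` every vertex `v ≠ v₀` has exactly one incoming edge, the one from its
neighbour closer to the root. We index the edges `e_v` by their terminal vertices `v ≠ v₀`. -/
abbrev Edge {V : Type*} (v₀ : V) : Type _ := {v : V // v ≠ v₀}

variable {V : Type*} [Fintype V] [DecidableEq V] (G : SimpleGraph V) [DecidableRel G.Adj] (v₀ : V)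

/-- There is an edge from `u` to `v` directed away from the root. -/
abbrev IsEdge (u v : V) : Prop := G.Adj u v ∧ G.dist v₀ v = G.dist v₀ u + 1

/-- `ψ(z) = det(-zD + A)`. -/
noncomputable def psi (z : ℂ) : ℂ := ((-z) • G.degMatrix ℂ + G.adjMatrix ℂ).det

/-- `ψ̂(z) = det(-zD̂ + Â)`, where `D̂` and `Â` are `D` and `A` without the row and the column of
the root. -/
noncomputable def psiHat (z : ℂ) : ℂ :=
  ((-z) • (G.degMatrix ℂ).submatrix (Subtype.val : Edge v₀ → V) Subtype.val +
    (G.adjMatrix ℂ).submatrix (Subtype.val : Edge v₀ → V) Subtype.val).det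

/-! A function `y` on the tree with `y_e = a_e c_e + b_e s_e` on each edge `e` is given by its
vector of unknowns, indexed by `Edge v₀ ⊕ Edge v₀`, with `inl e` for `a_e` and `inr e` for `b_e`.
The next four definitions are the coefficient vectors of linear forms in these unknowns. -/

/-- The form `y_e(0) = a_e`. -/
def valStart (e : Edge v₀) : Edge v₀ ⊕ Edge v₀ → ℂ := Pi.single (Sum.inl e) 1

/-- The form `y_e'(0) = b_e`. -/
def derivStart (e : Edge v₀) : Edge v₀ ⊕ Edge v₀ → ℂ := Pi.single (Sum.inr e) 1

variable {v₀} in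
/-- The form `y_e(ℓ) = a_e c_e(ℓ) + b_e s_e(ℓ)`. -/
noncomputable def valEnd (ℓ : ℝ) (q : Edge v₀ → ℝ → ℝ) (lam : ℂ) (e : Edge v₀) :
    Edge v₀ ⊕ Edge v₀ → ℂ :=
  Pi.single (Sum.inl e) (cEnd ℓ (q e) lam) + Pi.single (Sum.inr e) (sEnd ℓ (q e) lam)

variable {v₀} in
/-- The form `y_e'(ℓ) = a_e c_e'(ℓ) + b_e s_e'(ℓ)`. -/
noncomputable def derivEnd (ℓ : ℝ) (q : Edge v₀ → ℝ → ℝ) (lam : ℂ) (e : Edge v₀) :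
    Edge v₀ ⊕ Edge v₀ → ℂ :=
  Pi.single (Sum.inl e) (cDerivEnd ℓ (q e) lam) + Pi.single (Sum.inr e) (sDerivEnd ℓ (q e) lam)

variable {v₀}

/-- The condition at a vertex `u ≠ v₀` that belongs to the edge `e_v` starting at `u`: continuity,
`y_u(ℓ) - y_v(0) = 0`. The sum over `u` has exactly one term. -/
noncomputable def continuityRow (ℓ : ℝ) (q : Edge v₀ → ℝ → ℝ) (lam : ℂ) (v : Edge v₀) :
    Edge v₀ ⊕ Edge v₀ → ℂ :=
  (∑ u : Edge v₀, if IsEdge G v₀ u v then valEnd ℓ q lam u else 0) - valStart v₀ v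

/-- The condition at the end `v` of the edge `e_v`: Kirchhoff's condition
`y_v'(ℓ) - ∑ y_w'(0) = 0`, summed over all edges `e_w` starting at `v`. If `v` is pendant, the sum
is empty and this is Neumann's condition. -/
noncomputable def kirchhoffRow (ℓ : ℝ) (q : Edge v₀ → ℝ → ℝ) (lam : ℂ) (v : Edge v₀) :
    Edge v₀ ⊕ Edge v₀ → ℂ :=
  derivEnd ℓ q lam v - ∑ w : Edge v₀, if IsEdge G v₀ v w then derivStart v₀ w else 0

/-- The system of Problem D (rows are equations, columns are unknowns). Row `inl v` is the condition
for the edge `e_v` at its initial vertex (if that is the root: `y_v(0) = 0`), row `inr v` is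
Kirchhoff's condition at `v`. -/
noncomputable def systemD (ℓ : ℝ) (q : Edge v₀ → ℝ → ℝ) (lam : ℂ) :
    Matrix (Edge v₀ ⊕ Edge v₀) (Edge v₀ ⊕ Edge v₀) ℂ :=
  Matrix.of fun i => match i with
    | Sum.inl v => if G.Adj v₀ v then valStart v₀ v else continuityRow G ℓ q lam v
    | Sum.inr v => kirchhoffRow G ℓ q lam v

/-- The system of Problem N, where `e₁` is the first of the edges at the root. The conditions at the
root are Kirchhoff's condition `∑ y_k'(0) = 0`, summed over all edges at the root (row `inl e₁`), and
`y_{e₁}(0) - y_k(0) = 0` for the other edges `k` at the root (row `inl k`). If the root is pendant,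
this is Neumann's condition at the root. The other rows are those of Problem D. -/
noncomputable def systemN (e₁ : Edge v₀) (ℓ : ℝ) (q : Edge v₀ → ℝ → ℝ) (lam : ℂ) :
    Matrix (Edge v₀ ⊕ Edge v₀) (Edge v₀ ⊕ Edge v₀) ℂ :=
  Matrix.of fun i => match i with
    | Sum.inl v =>
      if v = e₁ then ∑ k : Edge v₀, if G.Adj v₀ k then derivStart v₀ k else 0
      else if G.Adj v₀ v then valStart v₀ e₁ - valStart v₀ v
      else continuityRow G ℓ q lam v
    | Sum.inr v => kirchhoffRow G ℓ q lam v

/-- The characteristic function `φ_D(lam) = det Φ_D(lam)`, where the characteristic matrix `Φ_D` is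
the matrix of the system, with the equations and the unknowns listed in the orders `rows` and
`cols`. -/
noncomputable def phiD {n : ℕ} (rows cols : Fin n ≃ Edge v₀ ⊕ Edge v₀)
    (ℓ : ℝ) (q : Edge v₀ → ℝ → ℝ) (lam : ℂ) : ℂ :=
  ((systemD G ℓ q lam).submatrix rows cols).det

/-- The characteristic function `φ_N(lam) = det Φ_N(lam)`, with the equations and the unknowns listed
in the orders `rows` and `cols`. -/
noncomputable def phiN (e₁ : Edge v₀) {n : ℕ} (rows cols : Fin n ≃ Edge v₀ ⊕ Edge v₀)
    (ℓ : ℝ) (q : Edge v₀ → ℝ → ℝ) (lam : ℂ) : ℂ :=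
  ((systemN G e₁ ℓ q lam).submatrix rows cols).det

/-- The sign of the order `rows` of the equations relative to the order `cols` of the unknowns, where
the equation with index `i` is paired with the unknown with the same index `i`. -/
def orderSign {n : ℕ} (rows cols : Fin n ≃ Edge v₀ ⊕ Edge v₀) : ℤˣ :=
  Equiv.Perm.sign (rows.symm.trans cols)

end RootedTree

/-- Integration by parts for the product of a primitive of an integrable function and a
continuously differentiable function. -/
theorem integral_primitive_mul_eq {x : ℝ} (hx : 0 ≤ x) {f G g : ℝ → ℂ}
    (hf : IntervalIntegrable f volume 0 x) (hG : ∀ t, HasDerivAt G (g t) t) (hg : Continuous g) :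
    ∫ s in (0 : ℝ)..x, (∫ t in (0 : ℝ)..s, f t) * g s =
      (∫ t in (0 : ℝ)..x, f t) * G x - ∫ t in (0 : ℝ)..x, f t * G t := by
  have hGc : Continuous G := continuous_iff_continuousAt.2 fun t => (hG t).continuousAt
  have hfi : Integrable f (volume.restrict (Ioc 0 x)) :=
    (intervalIntegrable_iff_integrableOn_Ioc_of_le hx).1 hf
  have hgi : Integrable g (volume.restrict (Ioc 0 x)) :=
    (intervalIntegrable_iff_integrableOn_Ioc_of_le hx).1 (hg.intervalIntegrable 0 x)
  have hint : Integrable (Function.uncurry fun s t => if t ≤ s then f t * g s else 0)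
      ((volume.restrict (Ioc 0 x)).prod (volume.restrict (Ioc 0 x))) := by
    have h1 := (hgi.mul_prod hfi).indicator (measurableSet_le measurable_snd measurable_fst)
    refine h1.congr (Filter.Eventually.of_forall fun p => ?_)
    simp only [indicator, mem_ofPred_eq, Function.uncurry]
    split_ifs <;> ring
  have hswap := integral_integral_swap hint
  have e1 : ∫ s in (0 : ℝ)..x, (∫ t in (0 : ℝ)..s, f t) * g s =
      ∫ s in Ioc 0 x, ∫ t in Ioc 0 x, if t ≤ s then f t * g s else 0 := by
    rw [intervalIntegral.integral_of_le hx]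
    refine setIntegral_congr_fun measurableSet_Ioc fun s hs => ?_
    have : (fun t => if t ≤ s then f t * g s else 0) = (Iic s).indicator fun t => f t * g s := by
      ext t; simp [indicator]
    rw [this, setIntegral_indicator measurableSet_Iic, ← intervalIntegral.integral_mul_const,
      intervalIntegral.integral_of_le hs.1.le]
    congr 2
    ext t
    simp only [mem_Ioc, mem_inter_iff, mem_Iic]
    exact ⟨fun h => ⟨⟨h.1, h.2.trans hs.2⟩, h.2⟩, fun h => ⟨h.1.1, h.2⟩⟩
  have e2 : ∫ t in (0 : ℝ)..x, f t * (G x - G t) =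
      ∫ t in Ioc 0 x, ∫ s in Ioc 0 x, if t ≤ s then f t * g s else 0 := by
    rw [intervalIntegral.integral_of_le hx]
    refine setIntegral_congr_fun measurableSet_Ioc fun t ht => ?_
    have : (fun s => if t ≤ s then f t * g s else 0) = (Ici t).indicator fun s => f t * g s := by
      ext s; simp [indicator]
    rw [this, setIntegral_indicator measurableSet_Ici,
      ← intervalIntegral.integral_eq_sub_of_hasDerivAt (fun s _ => hG s) (hg.intervalIntegrable _ _),
      ← intervalIntegral.integral_const_mul, intervalIntegral.integral_of_le ht.2,
      ← integral_Icc_eq_integral_Ioc]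
    congr 2
    ext s
    simp only [mem_Ioc, mem_inter_iff, mem_Ici, mem_Icc]
    exact ⟨fun h => ⟨⟨ht.1.trans_le h.1, h.2⟩, h.1⟩, fun h => ⟨h.2, h.1.2⟩⟩
  rw [e1, hswap, ← e2]
  simp only [mul_sub]
  rw [intervalIntegral.integral_sub (hf.mul_const _) (hf.mul_continuousOn hGc.continuousOn),
    intervalIntegral.integral_mul_const]

/-- Variation of constants for `w' = μ w + h` in integrated form. -/
theorem eq_exp_mul_of_eq_add_integral {ℓ : ℝ} {μ w₀ : ℂ} {w h : ℝ → ℂ}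
    (hw : ContinuousOn w (Icc 0 ℓ)) (hh : IntervalIntegrable h volume 0 ℓ)
    (heq : ∀ x ∈ Icc 0 ℓ, w x = w₀ + ∫ t in (0 : ℝ)..x, (μ * w t + h t)) {x : ℝ} (hx : x ∈ Icc 0 ℓ) :
    w x = Complex.exp (μ * x) * (w₀ + ∫ t in (0 : ℝ)..x, Complex.exp (-μ * t) * h t) := by
  have hG : ∀ t : ℝ, HasDerivAt (fun t : ℝ => Complex.exp (-μ * t)) (-μ * Complex.exp (-μ * t)) t := by
    intro t
    have := ((Complex.ofRealCLM.hasDerivAt (x := t)).const_mul (-μ)).cexp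
    simpa [mul_comm] using this
  have hsub : uIcc 0 x ⊆ Icc 0 ℓ := by rw [uIcc_of_le hx.1]; exact Icc_subset_Icc_right hx.2
  have hwc : ContinuousOn w (uIcc 0 x) := hw.mono hsub
  have hec : Continuous fun t : ℝ => Complex.exp (-μ * t) := by fun_prop
  have hwi : IntervalIntegrable (fun t => μ * w t) volume 0 x :=
    (hwc.intervalIntegrable).const_mul μ
  have hhi : IntervalIntegrable h volume 0 x :=
    hh.mono_set (by rw [uIcc_of_le (hx.1.trans hx.2)]; exact hsub)
  have hibp := integral_primitive_mul_eq hx.1 (hwi.add hhi) hG (by fun_prop)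
  have e0 : ∫ s in (0 : ℝ)..x, (∫ t in (0 : ℝ)..s, (μ * w t + h t)) * (-μ * Complex.exp (-μ * s)) =
      ∫ s in (0 : ℝ)..x, (w₀ * (μ * Complex.exp (-μ * s)) - μ * w s * Complex.exp (-μ * s)) := by
    refine intervalIntegral.integral_congr fun s hs => ?_
    linear_combination (μ * Complex.exp (-μ * s)) * heq s (hsub hs)
  have e1 : ∫ s in (0 : ℝ)..x, μ * Complex.exp (-μ * s) = 1 - Complex.exp (-μ * x) := by
    have := intervalIntegral.integral_eq_sub_of_hasDerivAt (fun s _ => hG s)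
      (Continuous.intervalIntegrable (by fun_prop) 0 x)
    simp only [neg_mul, intervalIntegral.integral_neg, Complex.ofReal_zero, mul_zero,
      Complex.exp_zero] at this ⊢
    linear_combination -this
  have i1 : IntervalIntegrable (fun s : ℝ => μ * w s * Complex.exp (-μ * s)) volume 0 x :=
    hwi.mul_continuousOn hec.continuousOn
  have i2 : IntervalIntegrable (fun s : ℝ => h s * Complex.exp (-μ * s)) volume 0 x :=
    hhi.mul_continuousOn hec.continuousOn
  rw [e0, intervalIntegral.integral_sub (Continuous.intervalIntegrable (by fun_prop) _ _) i1,
    intervalIntegral.integral_const_mul, e1] at hibp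
  have e4 := heq x hx
  simp only [add_mul] at hibp
  rw [intervalIntegral.integral_add i1 i2] at hibp
  have e2 : ∫ t in (0 : ℝ)..x, Complex.exp (-μ * t) * h t =
      ∫ t in (0 : ℝ)..x, h t * Complex.exp (-μ * t) := by simp only [mul_comm]
  have e3 : Complex.exp (μ * x) * Complex.exp (-μ * x) = 1 := by
    rw [← Complex.exp_add]; simp
  rw [e2]
  linear_combination (-Complex.exp (μ * x)) * hibp + e4 -
    (∫ t in (0 : ℝ)..x, (μ * w t + h t)) * e3 - w₀ * e3

/-- If `μ² = -lam`, then `w = y' + μ y` solves `w' = μ w + q y`. -/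
theorem IsSLSolution.deriv_add_mul_eq {ℓ : ℝ} {q : ℝ → ℝ} {lam a b μ : ℂ} {y dy : ℝ → ℂ}
    (hy : IsSLSolution ℓ q lam a b y dy) (hq : IntervalIntegrable q volume 0 ℓ) (hμ : μ ^ 2 = -lam)
    {x : ℝ} (hx : x ∈ Icc 0 ℓ) :
    dy x + μ * y x = Complex.exp (μ * x) *
      (b + μ * a + ∫ t in (0 : ℝ)..x, Complex.exp (-μ * t) * (q t * y t)) := by
  have hℓ : 0 ≤ ℓ := hx.1.trans hx.2
  have hyc : ContinuousOn y (uIcc 0 ℓ) := by rw [uIcc_of_le hℓ]; exact hy.continuousOn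
  have hqc : IntervalIntegrable (fun t => (q t : ℂ)) volume 0 ℓ :=
    ⟨hq.1.ofReal, hq.2.ofReal⟩
  refine eq_exp_mul_of_eq_add_integral (w := fun x => dy x + μ * y x)
    (h := fun t => q t * y t) (w₀ := b + μ * a)
    (hy.continuousOn_deriv.add (hy.continuousOn.const_mul μ)) (hqc.mul_continuousOn hyc)
    (fun x hx => ?_) hx
  have hsub : uIcc 0 x ⊆ uIcc 0 ℓ := by
    rw [uIcc_of_le hx.1, uIcc_of_le hℓ]; exact Icc_subset_Icc_right hx.2
  have i1 : IntervalIntegrable (fun t => ((q t : ℂ) - lam) * y t) volume 0 x :=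
    (((hqc.sub intervalIntegrable_const).mul_continuousOn hyc).mono_set hsub)
  have i2 : IntervalIntegrable dy volume 0 x := by
    refine (hy.continuousOn_deriv.mono ?_).intervalIntegrable
    rwa [uIcc_of_le hℓ] at hsub
  rw [hy.eq_deriv x hx, hy.eq x hx, mul_add, ← intervalIntegral.integral_const_mul,
    add_add_add_comm, ← intervalIntegral.integral_add i1 (i2.const_mul μ)]
  congr 1
  refine intervalIntegral.integral_congr fun t _ => ?_
  linear_combination (-y t) * hμ

/-- The values at `ℓ` of a solution for `lam = ρ²` differ little from those for `q = 0`. -/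
theorem IsSLSolution.norm_end_sub_le {ℓ : ℝ} (hℓ : 0 ≤ ℓ) {q : ℝ → ℝ} {ρ : ℝ} {a b : ℂ} {y dy : ℝ → ℂ}
    (hy : IsSLSolution ℓ q ((ρ ^ 2 : ℝ) : ℂ) a b y dy) (hq : IntervalIntegrable q volume 0 ℓ)
    (hρ : 0 < ρ) (hQ : 2 * ∫ t in (0 : ℝ)..ℓ, |q t| ≤ ρ) :
    ‖y ℓ - (a * Real.cos (ρ * ℓ) + b / ρ * Real.sin (ρ * ℓ))‖ ≤
      2 * (∫ t in (0 : ℝ)..ℓ, |q t|) * (‖b‖ + ρ * ‖a‖) / ρ ^ 2 ∧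
    ‖dy ℓ - (b * Real.cos (ρ * ℓ) - a * ρ * Real.sin (ρ * ℓ))‖ ≤
      2 * (∫ t in (0 : ℝ)..ℓ, |q t|) * (‖b‖ + ρ * ‖a‖) / ρ := by
  set Q := ∫ t in (0 : ℝ)..ℓ, |q t| with hQdef
  set m := ‖b‖ + ρ * ‖a‖ with hm
  have hQ0 : 0 ≤ Q := intervalIntegral.integral_nonneg hℓ fun t _ => abs_nonneg _
  have hρc : (ρ : ℂ) ≠ 0 := by exact_mod_cast hρ.ne'
  let W : ℂ → ℝ → ℂ := fun μ x => dy x + μ * y x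
  set P : ℂ := ρ * Complex.I with hP
  have hPn : ‖P‖ = ρ := by
    rw [hP, norm_mul, Complex.norm_I, mul_one, Complex.norm_real, Real.norm_of_nonneg hρ.le]
  have hPsq : P ^ 2 = -((ρ ^ 2 : ℝ) : ℂ) := by
    rw [hP, mul_pow, Complex.I_sq]; push_cast; ring
  have hexp : ∀ μ, μ = P ∨ μ = -P → ∀ x : ℝ, ‖Complex.exp (μ * x)‖ = 1 := by
    rintro μ (rfl | rfl) x <;> simp [Complex.norm_exp, hP]
  have hexp' : ∀ μ, μ = P ∨ μ = -P → ∀ x : ℝ, ‖Complex.exp (-μ * x)‖ = 1 := by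
    rintro μ (rfl | rfl) x <;> simp [Complex.norm_exp, hP]
  have hval : ∀ x, y x = (W P x - W (-P) x) / (2 * P) := by
    intro x
    have : P ≠ 0 := mul_ne_zero hρc Complex.I_ne_zero
    simp only [W]; field_simp; ring
  have hder : ∀ x, dy x = (W P x + W (-P) x) / 2 := by intro x; simp only [W]; ring
  obtain ⟨x₀, hx₀, hmax⟩ := isCompact_Icc.exists_isMaxOn (nonempty_Icc.2 hℓ)
    (f := fun x => max ‖W P x‖ ‖W (-P) x‖) (ContinuousOn.sup
      (hy.continuousOn_deriv.add (hy.continuousOn.const_mul _)).norm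
      (hy.continuousOn_deriv.add (hy.continuousOn.const_mul _)).norm)
  set M := max ‖W P x₀‖ ‖W (-P) x₀‖ with hM
  have hyM : ∀ x ∈ Icc 0 ℓ, ‖y x‖ ≤ M / ρ := by
    intro x hx
    have h1 : max ‖W P x‖ ‖W (-P) x‖ ≤ M := hmax hx
    rw [hval, norm_div, norm_mul, hPn, Complex.norm_ofNat, div_le_div_iff₀ (by positivity) hρ]
    have := norm_sub_le (W P x) (W (-P) x)
    have h2 := (le_max_left _ _).trans h1
    have h3 := (le_max_right _ _).trans h1
    nlinarith
  have hdiff : ∀ μ, μ = P ∨ μ = -P → ∀ x ∈ Icc 0 ℓ,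
      ‖W μ x - Complex.exp (μ * x) * (b + μ * a)‖ ≤ Q * (M / ρ) := by
    intro μ hμ x hx
    have hμ2 : μ ^ 2 = -((ρ ^ 2 : ℝ) : ℂ) := by rcases hμ with rfl | rfl <;> simp [hPsq]
    simp only [W]
    rw [hy.deriv_add_mul_eq hq hμ2 hx, mul_add, add_sub_cancel_left, norm_mul, hexp μ hμ, one_mul]
    have hsub : uIcc 0 x ⊆ uIcc 0 ℓ := by
      rw [uIcc_of_le hx.1, uIcc_of_le hℓ]; exact Icc_subset_Icc_right hx.2
    calc _ ≤ ∫ t in (0 : ℝ)..x, |q t| * (M / ρ) := by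
          refine intervalIntegral.norm_integral_le_of_norm_le hx.1
            (Filter.Eventually.of_forall fun t ht => ?_) ((hq.abs.mono_set hsub).mul_const _)
          rw [norm_mul, hexp' μ hμ, one_mul, norm_mul, Complex.norm_real, Real.norm_eq_abs]
          exact mul_le_mul_of_nonneg_left (hyM t ⟨ht.1.le, ht.2.trans hx.2⟩) (abs_nonneg _)
      _ = (∫ t in (0 : ℝ)..x, |q t|) * (M / ρ) := intervalIntegral.integral_mul_const _ _
      _ ≤ Q * (M / ρ) := by
          refine mul_le_mul_of_nonneg_right ?_ ((norm_nonneg _).trans (hyM x hx))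
          exact intervalIntegral.integral_mono_interval le_rfl hx.1 hx.2
            (Filter.Eventually.of_forall fun t => abs_nonneg _) hq.abs
  have hinit : ∀ μ, μ = P ∨ μ = -P → ‖b + μ * a‖ ≤ m := by
    intro μ hμ
    refine (norm_add_le _ _).trans ?_
    rw [norm_mul, hm, show ‖μ‖ = ρ by rcases hμ with rfl | rfl <;> simp [hPn]]
  have hM0 : 0 ≤ M := (norm_nonneg _).trans (le_max_left _ _)
  have hQM : Q * (M / ρ) ≤ M / 2 := by
    rw [mul_div_assoc', div_le_div_iff₀ hρ two_pos]
    nlinarith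
  have hle : ∀ μ, μ = P ∨ μ = -P → ‖W μ x₀‖ ≤ m + M / 2 := by
    intro μ hμ
    have h1 := hdiff μ hμ x₀ hx₀
    have h2 : ‖Complex.exp (μ * x₀) * (b + μ * a)‖ ≤ m := by
      rw [norm_mul, hexp μ hμ, one_mul]; exact hinit μ hμ
    have h3 := norm_sub_norm_le (W μ x₀) (Complex.exp (μ * x₀) * (b + μ * a))
    linarith
  have hMm : M ≤ 2 * m := by
    have : M ≤ m + M / 2 := max_le (hle P (Or.inl rfl)) (hle (-P) (Or.inr rfl))
    linarith
  have hfin : Q * (M / ρ) ≤ 2 * Q * m / ρ := by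
    rw [mul_div_assoc', div_le_div_iff_of_pos_right hρ]; nlinarith
  have hend : ℓ ∈ Icc 0 ℓ := ⟨hℓ, le_rfl⟩
  have d1 := (hdiff P (Or.inl rfl) ℓ hend).trans hfin
  have d2 := (hdiff (-P) (Or.inr rfl) ℓ hend).trans hfin
  have hc : ((Real.cos (ρ * ℓ) : ℝ) : ℂ) = (Complex.exp (P * ℓ) + Complex.exp (-P * ℓ)) / 2 := by
    rw [Complex.ofReal_cos, Complex.cos]; push_cast
    rw [show (ρ : ℂ) * ℓ * Complex.I = P * ℓ by rw [hP]; ring,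
      show -((ρ : ℂ) * ℓ) * Complex.I = -P * ℓ by rw [hP]; ring]
  have hs : ((Real.sin (ρ * ℓ) : ℝ) : ℂ) =
      (Complex.exp (-P * ℓ) - Complex.exp (P * ℓ)) * Complex.I / 2 := by
    rw [Complex.ofReal_sin, Complex.sin]; push_cast
    rw [show (ρ : ℂ) * ℓ * Complex.I = P * ℓ by rw [hP]; ring,
      show -((ρ : ℂ) * ℓ) * Complex.I = -P * ℓ by rw [hP]; ring]
  set w₁ := W P ℓ - Complex.exp (P * ℓ) * (b + P * a)
  set w₂ := W (-P) ℓ - Complex.exp (-P * ℓ) * (b + -P * a)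
  have e1 : y ℓ - (a * Real.cos (ρ * ℓ) + b / ρ * Real.sin (ρ * ℓ)) = (w₁ - w₂) / (2 * P) := by
    rw [hval, hc, hs]
    simp only [w₁, w₂, hP]
    have hI := Complex.I_ne_zero
    field_simp
    linear_combination (-b * (Complex.exp (-(ρ * Complex.I * ℓ)) -
      Complex.exp (ρ * Complex.I * ℓ))) * Complex.I_sq
  have e2 : dy ℓ - (b * Real.cos (ρ * ℓ) - a * ρ * Real.sin (ρ * ℓ)) = (w₁ + w₂) / 2 := by
    rw [hder, hc, hs]
    simp only [w₁, w₂, hP]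
    ring
  constructor
  · rw [e1, norm_div, norm_mul, hPn, Complex.norm_ofNat, div_le_iff₀ (by positivity)]
    refine (norm_sub_le _ _).trans ((add_le_add d1 d2).trans (le_of_eq ?_))
    field_simp; ring
  · rw [e2, norm_div, Complex.norm_ofNat, div_le_iff₀ two_pos]
    refine (norm_add_le _ _).trans ((add_le_add d1 d2).trans (le_of_eq ?_))
    ring

theorem slSolution_spec {ℓ : ℝ} (hℓ : 0 < ℓ) {q : ℝ → ℝ}
    (hq : MemLp q 2 (volume.restrict (Ioo 0 ℓ))) (lam a b : ℂ) :
    IsSLSolution ℓ q lam a b (slSolution ℓ q lam a b).1 (slSolution ℓ q lam a b).2 :=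
  Classical.epsilon_spec (exists_isSLSolution hℓ hq lam a b)

theorem intervalIntegrable_of_memLp_two {ℓ : ℝ} (hℓ : 0 ≤ ℓ) {q : ℝ → ℝ}
    (hq : MemLp q 2 (volume.restrict (Ioo 0 ℓ))) : IntervalIntegrable q volume 0 ℓ := by
  rw [intervalIntegrable_iff_integrableOn_Ioc_of_le hℓ, integrableOn_Ioc_iff_integrableOn_Ioo]
  exact hq.integrable (by norm_num)

/-- A bound `C / ρ` for the deviation of the scaled end values from those for `q = 0`. -/
theorem exists_endValues_le {ℓ : ℝ} (hℓ : 0 < ℓ) {q : ℝ → ℝ}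
    (hq : MemLp q 2 (volume.restrict (Ioo 0 ℓ))) :
    ∃ C : ℝ, 0 ≤ C ∧ ∀ lam : ℝ, C ≤ √lam → 0 < lam →
      ‖cEnd ℓ q lam - Real.cos (√lam * ℓ)‖ ≤ C / √lam ∧
      ‖√lam * sEnd ℓ q lam - Real.sin (√lam * ℓ)‖ ≤ C / √lam ∧
      ‖cDerivEnd ℓ q lam / √lam + Real.sin (√lam * ℓ)‖ ≤ C / √lam ∧
      ‖sDerivEnd ℓ q lam - Real.cos (√lam * ℓ)‖ ≤ C / √lam := by
  have hqi := intervalIntegrable_of_memLp_two hℓ.le hq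
  refine ⟨2 * ∫ t in (0 : ℝ)..ℓ, |q t|, mul_nonneg two_pos.le
    (intervalIntegral.integral_nonneg hℓ.le fun t _ => abs_nonneg _), fun lam hC hlam => ?_⟩
  set C := 2 * ∫ t in (0 : ℝ)..ℓ, |q t|
  set ρ := √lam with hρ
  have hρ0 : 0 < ρ := Real.sqrt_pos.2 hlam
  have hρc : (ρ : ℂ) ≠ 0 := by exact_mod_cast hρ0.ne'
  have hn : ‖(ρ : ℂ)‖ = ρ := by rw [Complex.norm_real, Real.norm_of_nonneg hρ0.le]
  have hlam2 : lam = ρ ^ 2 := (Real.sq_sqrt hlam.le).symm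
  have h1 := slSolution_spec hℓ hq (lam : ℂ) 1 0
  have h2 := slSolution_spec hℓ hq (lam : ℂ) 0 1
  rw [hlam2] at h1 h2 ⊢
  obtain ⟨c1, c2⟩ := h1.norm_end_sub_le hℓ.le hqi hρ0 hC
  obtain ⟨s1, s2⟩ := h2.norm_end_sub_le hℓ.le hqi hρ0 hC
  simp only [norm_zero, norm_one, zero_add, add_zero, mul_one, mul_zero, one_mul, zero_mul, zero_div,
    zero_sub, sub_zero, sub_neg_eq_add] at c1 c2 s1 s2
  refine ⟨?_, ?_, ?_, s2⟩
  · refine c1.trans (le_of_eq ?_); field_simp; rfl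
  · have : ρ * sEnd ℓ q ((ρ ^ 2 : ℝ) : ℂ) - Real.sin (ρ * ℓ) =
        ρ * (sEnd ℓ q ((ρ ^ 2 : ℝ) : ℂ) - 1 / ρ * Real.sin (ρ * ℓ)) := by field_simp
    rw [this, norm_mul, hn]
    refine (mul_le_mul_of_nonneg_left s1 hρ0.le).trans (le_of_eq ?_); field_simp; rfl
  · have : cDerivEnd ℓ q ((ρ ^ 2 : ℝ) : ℂ) / ρ + Real.sin (ρ * ℓ) =
        (cDerivEnd ℓ q ((ρ ^ 2 : ℝ) : ℂ) + ρ * Real.sin (ρ * ℓ)) / ρ := by field_simp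
    rw [this, norm_div, hn]
    refine (div_le_div_of_nonneg_right c2 hρ0.le).trans (le_of_eq ?_); field_simp; rfl

/-! ## Block determinants -/

theorem Matrix.det_fromBlocks_of_commute_top {m R : Type*} [Fintype m] [DecidableEq m] [CommRing R]
    {P Q : Matrix m m R} (R' S : Matrix m m R) (hPQ : Commute P Q) (hP : IsUnit P) :
    (Matrix.fromBlocks P Q R' S).det = (S * P - R' * Q).det := by
  have h : Matrix.fromBlocks P Q R' S * Matrix.fromBlocks 1 (-Q) 0 P =
      Matrix.fromBlocks P 0 R' (S * P - R' * Q) := by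
    rw [Matrix.fromBlocks_multiply]
    congr 1
    · simp
    · simp [hPQ.eq]
    · simp
    · simp [sub_eq_add_neg, add_comm]
  have h' := congrArg Matrix.det h
  rw [Matrix.det_mul, Matrix.det_fromBlocks_zero₂₁, Matrix.det_fromBlocks_zero₁₂, Matrix.det_one,
    one_mul, mul_comm] at h'
  exact ((Matrix.isUnit_iff_isUnit_det _).1 hP).mul_left_cancel h'

theorem Matrix.isNilpotent_of_grading {m R : Type*} [Fintype m] [DecidableEq m] [CommRing R]
    {E : Matrix m m R} (f : m → ℕ) (hE : ∀ v u, E v u ≠ 0 → f u < f v) : IsNilpotent E := by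
  have hk : ∀ k v u, (E ^ k) v u ≠ 0 → k ≤ f v := by
    intro k
    induction k with
    | zero => intro _ _ _; exact Nat.zero_le _
    | succ k ih =>
      intro v u h
      rw [pow_succ', Matrix.mul_apply] at h
      obtain ⟨w, -, hw⟩ := Finset.exists_ne_zero_of_sum_ne_zero h
      have h1 := hE v w (left_ne_zero_of_mul hw)
      have h2 := ih w u (right_ne_zero_of_mul hw)
      omega
  refine ⟨(∑ v, f v) + 1, ?_⟩
  ext v u
  by_contra h
  have h1 := hk _ v u h
  have h2 := Finset.single_le_sum (f := f) (fun i _ => Nat.zero_le _) (Finset.mem_univ v)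
  omega

theorem Matrix.det_fromBlocks_of_isNilpotent {m : Type*} [Fintype m] [DecidableEq m]
    {E : Matrix m m ℂ} (hE : IsNilpotent E) (c s : ℂ) (S : Matrix m m ℂ) :
    (Matrix.fromBlocks (c • E - 1) (s • E) (-s • 1) S).det =
      (S * (c • E - 1) + s ^ 2 • E).det := by
  rw [Matrix.det_fromBlocks_of_commute_top]
  · congr 1
    rw [smul_mul_assoc, one_mul, smul_smul, neg_mul, neg_smul, sub_neg_eq_add, sq]
  · exact ((((Commute.refl E).smul_left c).sub_left (Commute.one_left E)).smul_right s)
  · refine IsNilpotent.isUnit_sub_one ?_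
    obtain ⟨k, hk⟩ := hE
    exact ⟨k, by rw [smul_pow, hk, smul_zero]⟩

namespace RootedTree

section Parents

variable {V : Type*} {G : SimpleGraph V} {v₀ : V}

/-! ## Parents in a rooted tree -/

theorem IsEdge.unique (hG : G.IsTree) {u u' v : V} (h : IsEdge G v₀ u v) (h' : IsEdge G v₀ u' v) :
    u = u' := by
  have key : ∀ u, IsEdge G v₀ u v → ∃ p : G.Walk v₀ v, p.IsPath ∧ p.penultimate = u := by
    intro u h
    obtain ⟨p, hp⟩ := hG.connected.exists_walk_length_eq_dist v₀ u
    refine ⟨p.concat h.1, SimpleGraph.Walk.isPath_of_length_eq_dist _ ?_, by simp⟩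
    rw [SimpleGraph.Walk.length_concat, hp, h.2]
  obtain ⟨p, hp, rfl⟩ := key u h
  obtain ⟨p', hp', rfl⟩ := key u' h'
  have := (hG.isAcyclic.subsingleton_path v₀ v).elim ⟨p, hp⟩ ⟨p', hp'⟩
  rw [show p = p' from congrArg Subtype.val this]

theorem exists_isEdge (hG : G.IsTree) {v : V} (hv : v ≠ v₀) : ∃ u, IsEdge G v₀ u v := by
  obtain ⟨p, hp⟩ := hG.connected.exists_walk_length_eq_dist v v₀
  cases p with
  | nil => exact absurd rfl hv
  | @cons _ w _ h p =>
    refine ⟨w, h.symm, ?_⟩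
    have h1 := SimpleGraph.dist_le p
    rw [SimpleGraph.Walk.length_cons] at hp
    have h2 := hG.dist_eq_dist_add_one_of_adj v₀ h
    rw [SimpleGraph.dist_comm (u := v)] at hp
    rw [SimpleGraph.dist_comm (u := w)] at h1
    omega

theorem not_isEdge_root (u : V) : ¬ IsEdge G v₀ u v₀ := fun h => by
  have := h.2; rw [SimpleGraph.dist_self] at this; omega

theorem isEdge_root_iff {v : V} : IsEdge G v₀ v₀ v ↔ G.Adj v₀ v :=
  ⟨fun h => h.1, fun h => ⟨h, by rw [SimpleGraph.dist_self, SimpleGraph.dist_eq_one_iff_adj.2 h]⟩⟩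

theorem adj_iff (hG : G.IsTree) {u v : V} : G.Adj u v ↔ IsEdge G v₀ u v ∨ IsEdge G v₀ v u := by
  refine ⟨fun h => ?_, fun h => h.elim (·.1) (·.1.symm)⟩
  rcases hG.dist_eq_dist_add_one_of_adj v₀ h with h' | h'
  · exact Or.inr ⟨h.symm, h'⟩
  · exact Or.inl ⟨h, h'⟩

theorem IsEdge.not_isEdge {u v : V} (h : IsEdge G v₀ u v) : ¬ IsEdge G v₀ v u := fun h' => by
  have := h.2; have := h'.2; omega

variable [DecidableRel G.Adj]

variable (G v₀) in
/-- The matrix with entry `1` in the place `(v, u)` if there is an edge from `u` to `v`. -/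
noncomputable def parentMatrix : Matrix V V ℂ := Matrix.of fun v u => if IsEdge G v₀ u v then 1 else 0

theorem parentMatrix_apply (v u : V) :
    parentMatrix G v₀ v u = if IsEdge G v₀ u v then 1 else 0 := rfl

variable (G v₀) in
/-- The matrix `parentMatrix` without the row and the column of the root. -/
noncomputable def parentMatrixHat : Matrix (Edge v₀) (Edge v₀) ℂ :=
  (parentMatrix G v₀).submatrix Subtype.val Subtype.val

theorem parentMatrixHat_apply (v u : Edge v₀) :
    parentMatrixHat G v₀ v u = if IsEdge G v₀ u v then 1 else 0 := rfl

theorem adjMatrix_eq (hG : G.IsTree) :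
    G.adjMatrix ℂ = parentMatrix G v₀ + (parentMatrix G v₀).transpose := by
  ext u v
  rw [SimpleGraph.adjMatrix_apply, Matrix.add_apply, Matrix.transpose_apply, parentMatrix_apply,
    parentMatrix_apply]
  by_cases h : IsEdge G v₀ u v
  · rw [if_pos ((adj_iff hG).2 (Or.inl h)), if_neg h.not_isEdge, if_pos h, zero_add]
  · rw [if_neg h, add_zero]
    refine if_congr ?_ rfl rfl
    rw [adj_iff (v₀ := v₀) hG]
    exact or_iff_right h

theorem parentMatrixHat_eq_zero (hG : G.IsTree) {v : Edge v₀} (hv : G.Adj v₀ v) (w : Edge v₀) :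
    parentMatrixHat G v₀ v w = 0 := by
  rw [parentMatrixHat_apply, if_neg]
  exact fun h => w.2 (h.unique hG (isEdge_root_iff.2 hv))

end Parents

variable {V : Type*} [Fintype V] [DecidableEq V] {G : SimpleGraph V} {v₀ : V} [DecidableRel G.Adj]

@[to_additive]
theorem prod_edge {M : Type*} [CommMonoid M] (f : V → M) (hf : f v₀ = 1) :
    ∏ v : Edge v₀, f v = ∏ v, f v := by
  rw [← Finset.prod_filter_of_ne (p := (· ≠ v₀)) fun v _ h hv => h (hv ▸ hf)]
  exact (Finset.prod_subtype _ (by simp) f).symm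

theorem isNilpotent_parentMatrix : IsNilpotent (parentMatrix G v₀) :=
  Matrix.isNilpotent_of_grading (G.dist v₀) fun v u h => by
    rw [parentMatrix_apply, ite_ne_right_iff] at h
    have := h.1.2; omega

theorem isNilpotent_parentMatrixHat : IsNilpotent (parentMatrixHat G v₀) :=
  Matrix.isNilpotent_of_grading (fun v : Edge v₀ => G.dist v₀ v) fun v u h => by
    rw [parentMatrixHat_apply, ite_ne_right_iff] at h
    have := h.1.2; omega

theorem degMatrix_eq (hG : G.IsTree) :
    G.degMatrix ℂ = (parentMatrix G v₀).transpose * parentMatrix G v₀ +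
      Matrix.diagonal fun v => if v = v₀ then 0 else 1 := by
  ext u v
  simp only [SimpleGraph.degMatrix, Matrix.add_apply, Matrix.mul_apply, Matrix.transpose_apply,
    parentMatrix_apply]
  rcases eq_or_ne u v with rfl | huv
  · simp only [Matrix.diagonal_apply_eq]
    have h1 : (G.degree u : ℂ) = ∑ w, if G.Adj u w then (1 : ℂ) else 0 := by
      rw [← SimpleGraph.card_neighborFinset_eq_degree, SimpleGraph.neighborFinset_eq_filter,
        Finset.sum_boole]
    have h2 : ∀ w, (if G.Adj u w then (1 : ℂ) else 0) =
        (if IsEdge G v₀ u w then 1 else 0) * (if IsEdge G v₀ u w then 1 else 0) +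
          if IsEdge G v₀ w u then 1 else 0 := by
      intro w
      have := congrFun (congrFun (adjMatrix_eq (v₀ := v₀) hG) u) w
      rw [SimpleGraph.adjMatrix_apply, Matrix.add_apply, Matrix.transpose_apply, parentMatrix_apply,
        parentMatrix_apply] at this
      rw [this, add_comm]
      simp
    rw [h1, Finset.sum_congr rfl fun w _ => h2 w, Finset.sum_add_distrib]
    congr 1
    by_cases hu : u = v₀
    · subst hu
      simp [not_isEdge_root]
    · obtain ⟨p, hp⟩ := exists_isEdge hG hu
      rw [Finset.sum_eq_single p, if_pos hp, if_neg hu]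
      · exact fun w _ hw => if_neg fun h => hw (h.unique hG hp)
      · simp
  · rw [Matrix.diagonal_apply_ne _ huv, Matrix.diagonal_apply_ne _ huv, add_zero]
    refine (Finset.sum_eq_zero fun w _ => ?_).symm
    by_cases h : IsEdge G v₀ u w
    · rw [if_neg fun h' => huv (h.unique hG h'), mul_zero]
    · rw [if_neg h, zero_mul]

theorem parentMatrixHat_transpose_mul :
    (parentMatrixHat G v₀).transpose * parentMatrixHat G v₀ =
      ((parentMatrix G v₀).transpose * parentMatrix G v₀).submatrix Subtype.val Subtype.val := by
  ext u v
  simp only [parentMatrixHat, Matrix.mul_apply, Matrix.transpose_apply, Matrix.submatrix_apply]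
  exact sum_edge (fun w => parentMatrix G v₀ w u * parentMatrix G v₀ w v)
    (by simp [parentMatrix_apply, not_isEdge_root])

theorem psi_eq (hG : G.IsTree) (c : ℂ) :
    psi G c = (parentMatrix G v₀ + (parentMatrix G v₀).transpose -
      c • ((parentMatrix G v₀).transpose * parentMatrix G v₀ +
        Matrix.diagonal fun v => if v = v₀ then 0 else 1)).det := by
  rw [psi, ← degMatrix_eq hG, ← adjMatrix_eq hG]
  congr 1
  rw [neg_smul, sub_eq_add_neg, add_comm]

theorem psiHat_eq (hG : G.IsTree) (c : ℂ) :
    psiHat G v₀ c = (parentMatrixHat G v₀ + (parentMatrixHat G v₀).transpose -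
      c • ((parentMatrixHat G v₀).transpose * parentMatrixHat G v₀ + 1)).det := by
  rw [psiHat, degMatrix_eq (v₀ := v₀) hG, adjMatrix_eq (v₀ := v₀) hG, parentMatrixHat_transpose_mul]
  congr 1
  ext u v
  simp only [parentMatrixHat, Matrix.add_apply, Matrix.smul_apply, Matrix.submatrix_apply,
    Matrix.sub_apply, Matrix.transpose_apply, Matrix.diagonal_apply, Matrix.one_apply,
    Subtype.val_inj, if_neg u.2, smul_eq_mul]
  ring

theorem psiHat_eq_det_fromBlocks (hG : G.IsTree) {c s : ℂ} (hcs : c ^ 2 + s ^ 2 = 1) :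
    psiHat G v₀ c = (Matrix.fromBlocks (c • parentMatrixHat G v₀ - 1) (s • parentMatrixHat G v₀)
      (-s • 1) (c • 1 - (parentMatrixHat G v₀).transpose)).det := by
  rw [Matrix.det_fromBlocks_of_isNilpotent isNilpotent_parentMatrixHat, psiHat_eq hG]
  congr 1
  set E := parentMatrixHat G v₀
  have : E = c ^ 2 • E + s ^ 2 • E := by rw [← add_smul, hcs, one_smul]
  nth_rewrite 1 [this]
  simp only [sub_mul, mul_sub, smul_mul_assoc, mul_smul_comm, one_mul, mul_one, smul_add, smul_sub,
    smul_smul, sq]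
  abel

theorem psi_eq_det_fromBlocks (hG : G.IsTree) {c s : ℂ} (hcs : c ^ 2 + s ^ 2 = 1) :
    psi G c = (Matrix.fromBlocks (c • parentMatrix G v₀ - 1) (s • parentMatrix G v₀)
      (-s • 1) (c • (Matrix.diagonal fun v => if v = v₀ then 0 else 1) -
        (parentMatrix G v₀).transpose)).det := by
  rw [Matrix.det_fromBlocks_of_isNilpotent isNilpotent_parentMatrix, psi_eq (v₀ := v₀) hG]
  congr 1
  have h0 : (Matrix.diagonal fun v => if v = v₀ then 0 else 1) * parentMatrix G v₀ =
      parentMatrix G v₀ := by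
    ext v u
    rw [Matrix.diagonal_mul, parentMatrix_apply]
    by_cases hv : v = v₀
    · subst hv; simp [not_isEdge_root]
    · simp [hv]
  set E := parentMatrix G v₀
  have : E = c ^ 2 • E + s ^ 2 • E := by rw [← add_smul, hcs, one_smul]
  nth_rewrite 1 [this]
  simp only [sub_mul, mul_sub, smul_mul_assoc, mul_smul_comm, mul_one, smul_add, smul_sub,
    smul_smul, sq, h0]
  abel

/-! ## The systems as functions of the end values -/

variable (G) in
/-- The matrix of Problem D, where the values at the end of the edge `e` are `α e`, `β e` and the
derivatives are `γ e`, `δ e`. -/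
noncomputable def matrixD (α β γ δ : Edge v₀ → ℂ) :
    Matrix (Edge v₀ ⊕ Edge v₀) (Edge v₀ ⊕ Edge v₀) ℂ :=
  Matrix.fromBlocks
    (Matrix.of fun v w => parentMatrixHat G v₀ v w * α w +
      if v = w then (if G.Adj v₀ v then 1 else -1) else 0)
    (Matrix.of fun v w => parentMatrixHat G v₀ v w * β w)
    (Matrix.diagonal γ)
    (Matrix.diagonal δ - (parentMatrixHat G v₀).transpose)

variable (G) in
/-- The matrix of Problem N, where the values at the end of the edge `e` are `α e`, `β e` and the
derivatives are `γ e`, `δ e`. -/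
noncomputable def matrixN (e₁ : Edge v₀) (α β γ δ : Edge v₀ → ℂ) :
    Matrix (Edge v₀ ⊕ Edge v₀) (Edge v₀ ⊕ Edge v₀) ℂ :=
  Matrix.fromBlocks
    (Matrix.of fun v w => if v = e₁ then 0 else parentMatrixHat G v₀ v w * α w -
      (if v = w then 1 else 0) + if G.Adj v₀ v ∧ w = e₁ then 1 else 0)
    (Matrix.of fun v w => if v = e₁ then (if G.Adj v₀ w then 1 else 0) else
      parentMatrixHat G v₀ v w * β w)
    (Matrix.diagonal γ)
    (Matrix.diagonal δ - (parentMatrixHat G v₀).transpose)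

variable (ℓ : ℝ) (q : Edge v₀ → ℝ → ℝ) (lam : ℂ)

theorem kirchhoffRow_inl (v w : Edge v₀) : kirchhoffRow G ℓ q lam v (Sum.inl w) =
    Matrix.diagonal (fun e => cDerivEnd ℓ (q e) lam) v w := by
  simp only [kirchhoffRow, derivEnd, derivStart, Pi.sub_apply, Pi.add_apply, Finset.sum_apply,
    ite_apply, Pi.zero_apply, Pi.single_apply, Matrix.diagonal_apply]
  simp [eq_comm]

theorem kirchhoffRow_inr (v w : Edge v₀) : kirchhoffRow G ℓ q lam v (Sum.inr w) =
    (Matrix.diagonal (fun e => sDerivEnd ℓ (q e) lam) - (parentMatrixHat G v₀).transpose) v w := by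
  simp only [kirchhoffRow, derivEnd, derivStart, Pi.sub_apply, Pi.add_apply, Finset.sum_apply,
    ite_apply, Pi.zero_apply, Pi.single_apply, Matrix.diagonal_apply, Matrix.sub_apply,
    Matrix.transpose_apply, parentMatrixHat_apply]
  rw [Finset.sum_eq_single w (fun u _ hu => by simp [hu.symm]) (by simp)]
  simp [eq_comm]

theorem continuityRow_inl (v w : Edge v₀) : continuityRow G ℓ q lam v (Sum.inl w) =
    parentMatrixHat G v₀ v w * cEnd ℓ (q w) lam - if v = w then 1 else 0 := by
  simp only [continuityRow, valEnd, valStart, Pi.sub_apply, Pi.add_apply, Finset.sum_apply,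
    ite_apply, Pi.zero_apply, Pi.single_apply, parentMatrixHat_apply]
  rw [Finset.sum_eq_single w (fun u _ hu => by simp [hu.symm]) (by simp)]
  simp [eq_comm]

theorem continuityRow_inr (v w : Edge v₀) : continuityRow G ℓ q lam v (Sum.inr w) =
    parentMatrixHat G v₀ v w * sEnd ℓ (q w) lam := by
  simp only [continuityRow, valEnd, valStart, Pi.sub_apply, Pi.add_apply, Finset.sum_apply,
    ite_apply, Pi.zero_apply, Pi.single_apply, parentMatrixHat_apply]
  rw [Finset.sum_eq_single w (fun u _ hu => by simp [hu.symm]) (by simp)]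
  simp [eq_comm]

theorem systemD_eq (hG : G.IsTree) : systemD G ℓ q lam =
    matrixD G (fun e => cEnd ℓ (q e) lam) (fun e => sEnd ℓ (q e) lam)
      (fun e => cDerivEnd ℓ (q e) lam) (fun e => sDerivEnd ℓ (q e) lam) := by
  ext (v | v) (w | w)
  · by_cases hv : G.Adj v₀ v
    · simp [systemD, matrixD, hv, valStart, parentMatrixHat_eq_zero hG hv, Pi.single_apply, eq_comm]
    · simp only [systemD, matrixD, hv, Matrix.of_apply, continuityRow_inl, if_false,
        Matrix.fromBlocks_apply₁₁]
      split_ifs <;> ring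
  · by_cases hv : G.Adj v₀ v
    · simp [systemD, matrixD, hv, valStart, parentMatrixHat_eq_zero hG hv]
    · simp [systemD, matrixD, hv, continuityRow_inr]
  · exact kirchhoffRow_inl ℓ q lam v w
  · exact kirchhoffRow_inr ℓ q lam v w

theorem systemN_eq (hG : G.IsTree) (e₁ : Edge v₀) : systemN G e₁ ℓ q lam =
    matrixN G e₁ (fun e => cEnd ℓ (q e) lam) (fun e => sEnd ℓ (q e) lam)
      (fun e => cDerivEnd ℓ (q e) lam) (fun e => sDerivEnd ℓ (q e) lam) := by
  ext (v | v) (w | w)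
  · by_cases he : v = e₁
    · simp only [systemN, matrixN, he, if_true, Matrix.of_apply, Finset.sum_apply, ite_apply,
        derivStart, Matrix.fromBlocks_apply₁₁]
      simp
    · by_cases hv : G.Adj v₀ v
      · simp only [systemN, matrixN, Matrix.of_apply, if_neg he, if_true, valStart,
          parentMatrixHat_eq_zero hG hv, Pi.single_apply, Pi.sub_apply, Sum.inl.injEq,
          Matrix.fromBlocks_apply₁₁, hv, true_and, @eq_comm _ w v]
        ring
      · simp [systemN, matrixN, hv, he, continuityRow_inl]
  · by_cases he : v = e₁
    · simp only [systemN, matrixN, he, if_true, Matrix.of_apply, Finset.sum_apply, ite_apply,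
        derivStart, Matrix.fromBlocks_apply₁₂, Pi.single_apply]
      rw [Finset.sum_eq_single w (fun u _ hu => by simp [hu.symm]) (by simp)]
      simp
    · by_cases hv : G.Adj v₀ v
      · simp [systemN, matrixN, hv, he, valStart, parentMatrixHat_eq_zero hG hv]
      · simp [systemN, matrixN, hv, he, continuityRow_inr]
  · exact kirchhoffRow_inl ℓ q lam v w
  · exact kirchhoffRow_inr ℓ q lam v w

/-! ## Scaling -/

theorem det_matrixD_scale (α β γ δ : Edge v₀ → ℂ) {ρ : ℂ} (hρ : ρ ≠ 0) :
    (matrixD G α β γ δ).det = (matrixD G α (fun e => ρ * β e) (fun e => γ e / ρ) δ).det := by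
  have h := Matrix.det_mul_row (Sum.elim (fun _ : Edge v₀ => 1) fun _ : Edge v₀ => ρ)
    (Matrix.of fun i j => (Sum.elim (fun _ : Edge v₀ => 1) fun _ : Edge v₀ => ρ⁻¹) i *
      matrixD G α β γ δ i j)
  rw [Matrix.det_mul_column] at h
  simp only [Fintype.prod_sum_type, Sum.elim_inl, Sum.elim_inr, Finset.prod_const_one, one_mul,
    Finset.prod_const, ← mul_assoc, ← mul_pow, mul_inv_cancel₀ hρ, one_pow] at h
  rw [← h]
  congr 1
  ext (v | v) (w | w)
  · simp [matrixD]
  · simp [matrixD]; ring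
  · simp [matrixD, Matrix.diagonal_apply, div_eq_inv_mul]
  · simp [matrixD]; field_simp

theorem det_matrixN_scale (e₁ : Edge v₀) (α β γ δ : Edge v₀ → ℂ) {ρ : ℂ} (hρ : ρ ≠ 0) :
    (matrixN G e₁ α β γ δ).det =
      ρ * (matrixN G e₁ α (fun e => ρ * β e) (fun e => γ e / ρ) δ).det := by
  have h := Matrix.det_mul_row (Sum.elim (fun _ : Edge v₀ => 1) fun _ : Edge v₀ => ρ)
    (Matrix.of fun i j => (Sum.elim (fun v : Edge v₀ => if v = e₁ then ρ⁻¹ else 1)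
      fun _ : Edge v₀ => ρ⁻¹) i * matrixN G e₁ α β γ δ i j)
  rw [Matrix.det_mul_column] at h
  simp only [Fintype.prod_sum_type, Sum.elim_inl, Sum.elim_inr, Finset.prod_const_one, one_mul,
    Finset.prod_const, Finset.prod_ite_eq', Finset.mem_univ, if_true] at h
  have h1 : ρ ^ (Finset.univ : Finset (Edge v₀)).card *
      (ρ⁻¹ * ρ⁻¹ ^ (Finset.univ : Finset (Edge v₀)).card * (matrixN G e₁ α β γ δ).det) =
    ρ⁻¹ * (matrixN G e₁ α β γ δ).det := by
    rw [inv_pow]; field_simp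
  rw [h1] at h
  rw [← mul_inv_cancel_left₀ hρ (matrixN G e₁ α β γ δ).det, ← h]
  congr 2
  ext (v | v) (w | w)
  · by_cases he : v = e₁ <;> simp [matrixN, he]
  · by_cases he : v = e₁ <;> simp [matrixN, he, hρ]
    ring
  · simp [matrixN, Matrix.diagonal_apply, div_eq_inv_mul]
  · simp [matrixN]; field_simp

/-! ## The determinants for zero potentials -/

theorem det_matrixD_const (hG : G.IsTree) {c s : ℂ} (hcs : c ^ 2 + s ^ 2 = 1) :
    (matrixD G (v₀ := v₀) (fun _ => c) (fun _ => s) (fun _ => -s) fun _ => c).det =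
      (-1) ^ G.degree v₀ * psiHat G v₀ c := by
  have h := Matrix.det_mul_column (Sum.elim (fun v : Edge v₀ => if G.Adj v₀ v then -1 else 1)
    fun _ : Edge v₀ => 1) (Matrix.fromBlocks (c • parentMatrixHat G v₀ - 1)
      (s • parentMatrixHat G v₀) (-s • 1) (c • 1 - (parentMatrixHat G v₀).transpose))
  rw [← psiHat_eq_det_fromBlocks hG hcs] at h
  simp only [Fintype.prod_sum_type, Sum.elim_inl, Sum.elim_inr, Finset.prod_const_one, mul_one] at h
  rw [prod_edge (fun v => if G.Adj v₀ v then (-1 : ℂ) else 1) (by simp), Finset.prod_ite,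
    Finset.prod_const_one, mul_one, Finset.prod_const, ← SimpleGraph.neighborFinset_eq_filter,
    SimpleGraph.card_neighborFinset_eq_degree] at h
  rw [← h]
  congr 1
  ext (v | v) (w | w)
  · by_cases hv : G.Adj v₀ v
    · rcases eq_or_ne v w with rfl | hvw
      · simp [matrixD, hv, parentMatrixHat_eq_zero hG hv]
      · simp [matrixD, parentMatrixHat_eq_zero hG hv, hvw]
    · simp [matrixD, hv, Matrix.one_apply, mul_comm, sub_eq_add_neg]
      split_ifs <;> simp
  · by_cases hv : G.Adj v₀ v
    · simp [matrixD, hv, parentMatrixHat_eq_zero hG hv]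
    · simp [matrixD, hv, mul_comm]
  · by_cases hvw : v = w <;> simp [matrixD, hvw]
  · simp [matrixD, Matrix.diagonal_apply, Matrix.one_apply]

theorem det_matrixN_const_of_eq_zero (e₁ : Edge v₀) (c : ℂ) :
    (matrixN G e₁ (fun _ => c) (fun _ => 0) (fun _ => -0) fun _ => c).det = 0 := by
  rw [matrixN, neg_zero, show Matrix.diagonal (fun _ : Edge v₀ => (0 : ℂ)) = 0 from
    Matrix.diagonal_zero, Matrix.det_fromBlocks_zero₂₁, Matrix.det_eq_zero_of_row_eq_zero e₁,
    zero_mul]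
  intro w
  simp

end RootedTree

namespace RootedTree

section Double

variable {V : Type*} [DecidableEq V] {v₀ : V}

variable (v₀) in
/-- The vertices other than the root, twice, together with two copies of the root. -/
noncomputable def doubleEquiv : Bool ⊕ (Edge v₀ ⊕ Edge v₀) ≃ V ⊕ V :=
  Equiv.ofBijective
    (Sum.elim (fun b => if b then Sum.inr v₀ else Sum.inl v₀) (Sum.map Subtype.val Subtype.val)) <| by
    constructor
    · rintro ((_ | _) | (v | v)) ((_ | _) | (w | w)) h <;>
        simp_all [Subtype.ext_iff]
      · exact w.2 h.symm
      · exact w.2 h.symm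
      · exact v.2 h
      · exact v.2 h
    · rintro (v | v) <;> by_cases hv : v = v₀
      · exact ⟨Sum.inl false, by simp [hv]⟩
      · exact ⟨Sum.inr (Sum.inl ⟨v, hv⟩), rfl⟩
      · exact ⟨Sum.inl true, by simp [hv]⟩
      · exact ⟨Sum.inr (Sum.inr ⟨v, hv⟩), rfl⟩

@[simp] theorem doubleEquiv_false : doubleEquiv v₀ (Sum.inl false) = Sum.inl v₀ := rfl
@[simp] theorem doubleEquiv_true : doubleEquiv v₀ (Sum.inl true) = Sum.inr v₀ := rfl
@[simp] theorem doubleEquiv_inl (v : Edge v₀) :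
    doubleEquiv v₀ (Sum.inr (Sum.inl v)) = Sum.inl v.1 := rfl
@[simp] theorem doubleEquiv_inr (v : Edge v₀) :
    doubleEquiv v₀ (Sum.inr (Sum.inr v)) = Sum.inr v.1 := rfl

end Double

variable {V : Type*} [Fintype V] [DecidableEq V] {G : SimpleGraph V} {v₀ : V} [DecidableRel G.Adj]

theorem mul_det_matrixN_const (hG : G.IsTree) (e₁ : Edge v₀) (he₁ : G.Adj v₀ e₁) {c s : ℂ}
    (hcs : c ^ 2 + s ^ 2 = 1) (hs : s ≠ 0) :
    s * (matrixN G e₁ (fun _ => c) (fun _ => s) (fun _ => -s) fun _ => c).det = -psi G c := by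
  set N := Matrix.fromBlocks (c • parentMatrix G v₀ - 1) (s • parentMatrix G v₀)
      (-s • 1) (c • (Matrix.diagonal fun v => if v = v₀ then 0 else 1) -
        (parentMatrix G v₀).transpose) with hN
  set σ : Equiv.Perm (V ⊕ V) := Equiv.swap (Sum.inl e₁.1) (Sum.inr v₀) with hσ
  set B := (N.submatrix σ id).submatrix (doubleEquiv v₀) (doubleEquiv v₀) with hB
  have hdetB : B.det = -psi G c := by
    rw [hB, Matrix.det_submatrix_equiv_self, Matrix.det_permute, hσ,
      Equiv.Perm.sign_swap Sum.inl_ne_inr, psi_eq_det_fromBlocks (v₀ := v₀) hG hcs]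
    simp [hN]
  have r0 : σ (Sum.inl v₀) = Sum.inl v₀ :=
    Equiv.swap_apply_of_ne_of_ne (fun h => e₁.2 (Sum.inl.inj h).symm) Sum.inl_ne_inr
  have r1 : σ (Sum.inr v₀) = Sum.inl e₁.1 := Equiv.swap_apply_right _ _
  have r2 : σ (Sum.inl e₁.1) = Sum.inr v₀ := Equiv.swap_apply_left _ _
  have r3 : ∀ v : Edge v₀, v ≠ e₁ → σ (Sum.inl v.1) = Sum.inl v.1 := fun v hv =>
    Equiv.swap_apply_of_ne_of_ne (fun h => hv (Subtype.ext (Sum.inl.inj h))) Sum.inl_ne_inr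
  have r4 : ∀ v : Edge v₀, σ (Sum.inr v.1) = Sum.inr v.1 := fun v =>
    Equiv.swap_apply_of_ne_of_ne Sum.inr_ne_inl (fun h => v.2 (Sum.inr.inj h))
  let T : Matrix Bool (Edge v₀ ⊕ Edge v₀) ℂ :=
    Matrix.of fun b j => if b = true ∧ j = Sum.inl e₁ then s⁻¹ else 0
  let r : Edge v₀ ⊕ Edge v₀ → ℂ := fun i => if i = Sum.inl e₁ then -1 else 1
  let W := Matrix.of fun i j => r i *
    matrixN G e₁ (fun _ => c) (fun _ => s) (fun _ => -s) (fun _ => c) i j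
  have hX : B.toBlocks₁₁ * T + B.toBlocks₁₂ = 0 := by
    ext (_ | _) (w | w)
    · simp [Matrix.mul_apply, Matrix.toBlocks₁₁, Matrix.toBlocks₁₂, T, hB, r0, hN,
        parentMatrix_apply, not_isEdge_root, w.2.symm]
    · simp [Matrix.mul_apply, Matrix.toBlocks₁₁, Matrix.toBlocks₁₂, T, hB, r0, hN,
        parentMatrix_apply, not_isEdge_root]
    · have : ¬ IsEdge G v₀ w.1 e₁.1 := fun h => w.2 (h.unique hG (isEdge_root_iff.2 he₁))
      rcases eq_or_ne w e₁ with rfl | hw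
      · simp [Matrix.mul_apply, Matrix.toBlocks₁₁, Matrix.toBlocks₁₂, T, hB, r1, hN,
          parentMatrix_apply, isEdge_root_iff, he₁, hs]
      · simp [Matrix.mul_apply, Matrix.toBlocks₁₁, Matrix.toBlocks₁₂, T, hB, r1, hN,
          parentMatrix_apply, hw, this, Subtype.val_inj, hw.symm]
    · have : ¬ IsEdge G v₀ w.1 e₁.1 := fun h => w.2 (h.unique hG (isEdge_root_iff.2 he₁))
      simp [Matrix.mul_apply, Matrix.toBlocks₁₁, Matrix.toBlocks₁₂, T, hB, r1, hN,
          parentMatrix_apply, this]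
  have hW : B.toBlocks₂₁ * T + B.toBlocks₂₂ = W := by
    have hA : ∀ v w : Edge v₀, parentMatrix G v₀ v w = parentMatrixHat G v₀ v w := fun _ _ => rfl
    have hR : ∀ w : Edge v₀, parentMatrix G v₀ w v₀ = if G.Adj v₀ w then 1 else 0 := fun w => by
      rw [parentMatrix_apply]; exact if_congr isEdge_root_iff rfl rfl
    have hR' : ∀ w : V, parentMatrix G v₀ v₀ w = 0 := fun w => by
      rw [parentMatrix_apply, if_neg (not_isEdge_root w)]
    have n11 : ∀ v w, N (Sum.inl v) (Sum.inl w) =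
        c * parentMatrix G v₀ v w - if v = w then 1 else 0 := fun v w => by
      simp [hN, Matrix.one_apply]
    have n12 : ∀ v w, N (Sum.inl v) (Sum.inr w) = s * parentMatrix G v₀ v w := fun v w => rfl
    have n21 : ∀ v w, N (Sum.inr v) (Sum.inl w) = if v = w then -s else 0 := fun v w => by
      by_cases h : v = w <;> simp [hN, h]
    have n22 : ∀ v w, N (Sum.inr v) (Sum.inr w) =
        (if v = w then (if v = v₀ then 0 else c) else 0) - parentMatrix G v₀ w v := fun v w => by
      simp [hN, Matrix.diagonal_apply]
    have hE : ∀ i j, (B.toBlocks₂₁ * T + B.toBlocks₂₂) i j =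
        (if j = Sum.inl e₁ then N (σ (doubleEquiv v₀ (Sum.inr i))) (Sum.inr v₀) * s⁻¹ else 0) +
          N (σ (doubleEquiv v₀ (Sum.inr i))) (doubleEquiv v₀ (Sum.inr j)) := fun i j => by
      simp [Matrix.mul_apply, Matrix.toBlocks₂₁, Matrix.toBlocks₂₂, T, hB]
    ext (v | v) (w | w)
    · rw [hE]
      rcases eq_or_ne v e₁ with rfl | hv
      · simp [W, r, matrixN, r2, n21, n22, hR', w.2.symm]
      · simp only [W, r, matrixN, doubleEquiv_inl, r3 v hv, n11, n12, hA, hR, Sum.inl.injEq, hv,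
          Matrix.of_apply, Matrix.fromBlocks_apply₁₁, if_false, Subtype.val_inj]
        by_cases h : G.Adj v₀ v <;> by_cases hw : w = e₁ <;> simp [h, hw, hs] <;> ring
    · rw [hE]
      rcases eq_or_ne v e₁ with rfl | hv
      · simp [W, r, matrixN, r2, n22, hR, w.2.symm]
      · simp [W, r, matrixN, r3 v hv, n12, hv, hA, mul_comm]
    · rw [hE]
      simp [W, r, matrixN, r4, n21, n22, v.2, hR', Matrix.diagonal_apply, Subtype.val_inj]
    · rw [hE]
      simp [W, r, matrixN, r4, n22, v.2, hA, Matrix.diagonal_apply, Subtype.val_inj]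
  have hmul : B * Matrix.fromBlocks 1 T 0 1 = Matrix.fromBlocks B.toBlocks₁₁ 0 B.toBlocks₂₁ W := by
    conv_lhs => rw [← Matrix.fromBlocks_toBlocks B]
    rw [Matrix.fromBlocks_multiply, ← hX, ← hW]
    simp
  have hdet := congrArg Matrix.det hmul
  have hWdet : W.det = -(matrixN G e₁ (fun _ => c) (fun _ => s) (fun _ => -s) fun _ => c).det := by
    rw [Matrix.det_mul_column]
    simp [r, Finset.prod_ite_eq']
  have hXdet : B.toBlocks₁₁.det = -s := by
    rw [← Matrix.det_submatrix_equiv_self finTwoEquiv, Matrix.det_fin_two]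
    simp [Matrix.toBlocks₁₁, hB, r0, r1, hN, parentMatrix_apply, not_isEdge_root, isEdge_root_iff,
      he₁, show finTwoEquiv 0 = false from rfl, show finTwoEquiv 1 = true from rfl]
  rw [Matrix.det_mul, Matrix.det_fromBlocks_zero₂₁, Matrix.det_fromBlocks_zero₁₂, hdetB, hWdet,
    hXdet] at hdet
  simp only [Matrix.det_one, mul_one] at hdet
  rw [hdet]; ring

end RootedTree

/-! ## Perturbation of determinants -/

theorem Asymptotics.isBigO_prod_sub_prod {ι X : Type*} {l : Filter X} {h : X → ℝ}
    (hh : h =O[l] fun _ => (1 : ℝ)) (S : Finset ι) {f g : ι → X → ℂ}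
    (hfg : ∀ i, (fun x => f i x - g i x) =O[l] h) (hg : ∀ i, g i =O[l] fun _ => (1 : ℝ)) :
    (fun x => ∏ i ∈ S, f i x) =O[l] (fun _ => (1 : ℝ)) ∧
      (fun x => ∏ i ∈ S, f i x - ∏ i ∈ S, g i x) =O[l] h := by
  classical
  induction S using Finset.induction_on with
  | empty => exact ⟨by simpa using isBigO_const_const (1 : ℂ) (one_ne_zero (α := ℝ)) l,
      by simpa using isBigO_zero h l⟩
  | insert a S ha ih =>
    have hf : f a =O[l] fun _ => (1 : ℝ) := by
      simpa using ((hfg a).trans hh).add (hg a)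
    refine ⟨by simpa [Finset.prod_insert ha] using hf.mul ih.1, ?_⟩
    have h1 := (hfg a).mul ih.1
    have h2 := (hg a).mul ih.2
    simp only [mul_one, one_mul] at h1 h2
    refine (h1.add h2).congr_left fun x => ?_
    rw [Finset.prod_insert ha, Finset.prod_insert ha]
    ring

theorem Matrix.isBigO_det_sub_det {m X : Type*} [Fintype m] [DecidableEq m] {l : Filter X}
    {h : X → ℝ} (hh : h =O[l] fun _ => (1 : ℝ)) {M N : X → Matrix m m ℂ}
    (hMN : ∀ i j, (fun x => M x i j - N x i j) =O[l] h)
    (hN : ∀ i j, (fun x => N x i j) =O[l] fun _ => (1 : ℝ)) :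
    (fun x => (M x).det - (N x).det) =O[l] h := by
  simp only [Matrix.det_apply', ← Finset.sum_sub_distrib, ← mul_sub]
  refine IsBigO.fun_sum fun σ _ => ?_
  exact (Asymptotics.isBigO_prod_sub_prod hh _ (fun i => hMN (σ i) i)
    fun i => hN (σ i) i).2.const_mul_left _

namespace RootedTree

variable {V : Type*} [Fintype V] [DecidableEq V] {G : SimpleGraph V} {v₀ : V} [DecidableRel G.Adj]

theorem det_submatrix_eq {n : ℕ} (rows cols : Fin n ≃ Edge v₀ ⊕ Edge v₀)
    (M : Matrix (Edge v₀ ⊕ Edge v₀) (Edge v₀ ⊕ Edge v₀) ℂ) :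
    (M.submatrix rows cols).det = (orderSign rows cols : ℤ) * M.det := by
  have h : M.submatrix rows cols = (M.submatrix (cols.symm.trans rows) id).submatrix cols cols := by
    ext i j; simp
  rw [h, Matrix.det_submatrix_equiv_self, Matrix.det_permute, orderSign,
    ← Equiv.Perm.sign_symm]
  rfl

section Perturbation

variable {X : Type*} {l : Filter X} {h : X → ℝ} {α β γ δ : X → Edge v₀ → ℂ} {c s : X → ℂ}

theorem isBigO_det_matrixD_sub (hh : h =O[l] fun _ => (1 : ℝ))
    (hc : c =O[l] fun _ => (1 : ℝ)) (hs : s =O[l] fun _ => (1 : ℝ))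
    (hα : ∀ e, (fun x => α x e - c x) =O[l] h) (hβ : ∀ e, (fun x => β x e - s x) =O[l] h)
    (hγ : ∀ e, (fun x => γ x e - -s x) =O[l] h) (hδ : ∀ e, (fun x => δ x e - c x) =O[l] h) :
    (fun x => (matrixD G (α x) (β x) (γ x) (δ x)).det -
      (matrixD G (v₀ := v₀) (fun _ => c x) (fun _ => s x) (fun _ => -s x) fun _ => c x).det)
      =O[l] h := by
  have hcst : ∀ a : ℂ, (fun _ : X => a) =O[l] fun _ => (1 : ℝ) := fun a =>
    isBigO_const_const a one_ne_zero l
  refine Matrix.isBigO_det_sub_det hh ?_ ?_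
  · rintro (v | v) (w | w)
    · refine ((hα w).const_mul_left (parentMatrixHat G v₀ v w)).congr_left fun x => ?_
      simp only [matrixD, Matrix.fromBlocks_apply₁₁, Matrix.of_apply]; ring
    · refine ((hβ w).const_mul_left (parentMatrixHat G v₀ v w)).congr_left fun x => ?_
      simp only [matrixD, Matrix.fromBlocks_apply₁₂, Matrix.of_apply]; ring
    · refine ((hγ v).const_mul_left (if v = w then 1 else 0)).congr_left fun x => ?_
      simp only [matrixD, Matrix.fromBlocks_apply₂₁, Matrix.diagonal_apply]; split_ifs <;> ring
    · refine ((hδ v).const_mul_left (if v = w then 1 else 0)).congr_left fun x => ?_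
      simp only [matrixD, Matrix.fromBlocks_apply₂₂, Matrix.diagonal_apply, Matrix.sub_apply]
      split_ifs <;> ring
  · rintro (v | v) (w | w)
    · exact (hc.const_mul_left _).add (hcst _)
    · exact hs.const_mul_left _
    · refine (hs.const_mul_left (if v = w then -1 else 0)).congr_left fun x => ?_
      simp only [matrixD, Matrix.fromBlocks_apply₂₁, Matrix.diagonal_apply]; split_ifs <;> ring
    · refine ((hc.const_mul_left (if v = w then 1 else 0)).add
        (hcst (-parentMatrixHat G v₀ w v))).congr_left fun x => ?_
      simp only [matrixD, Matrix.fromBlocks_apply₂₂, Matrix.diagonal_apply, Matrix.sub_apply,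
        Matrix.transpose_apply]
      split_ifs <;> ring

theorem isBigO_det_matrixN_sub (e₁ : Edge v₀) (hh : h =O[l] fun _ => (1 : ℝ))
    (hc : c =O[l] fun _ => (1 : ℝ)) (hs : s =O[l] fun _ => (1 : ℝ))
    (hα : ∀ e, (fun x => α x e - c x) =O[l] h) (hβ : ∀ e, (fun x => β x e - s x) =O[l] h)
    (hγ : ∀ e, (fun x => γ x e - -s x) =O[l] h) (hδ : ∀ e, (fun x => δ x e - c x) =O[l] h) :
    (fun x => (matrixN G e₁ (α x) (β x) (γ x) (δ x)).det -
      (matrixN G e₁ (fun _ => c x) (fun _ => s x) (fun _ => -s x) fun _ => c x).det)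
      =O[l] h := by
  have hcst : ∀ a : ℂ, (fun _ : X => a) =O[l] fun _ => (1 : ℝ) := fun a =>
    isBigO_const_const a one_ne_zero l
  refine Matrix.isBigO_det_sub_det hh ?_ ?_
  · rintro (v | v) (w | w)
    · refine ((hα w).const_mul_left
        (if v = e₁ then 0 else parentMatrixHat G v₀ v w)).congr_left fun x => ?_
      simp only [matrixN, Matrix.fromBlocks_apply₁₁, Matrix.of_apply]
      by_cases hv : v = e₁ <;> simp only [hv, if_true, if_false] <;> ring
    · refine ((hβ w).const_mul_left
        (if v = e₁ then 0 else parentMatrixHat G v₀ v w)).congr_left fun x => ?_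
      simp only [matrixN, Matrix.fromBlocks_apply₁₂, Matrix.of_apply]
      by_cases hv : v = e₁ <;> simp only [hv, if_true, if_false] <;> ring
    · refine ((hγ v).const_mul_left (if v = w then 1 else 0)).congr_left fun x => ?_
      simp only [matrixN, Matrix.fromBlocks_apply₂₁, Matrix.diagonal_apply]; split_ifs <;> ring
    · refine ((hδ v).const_mul_left (if v = w then 1 else 0)).congr_left fun x => ?_
      simp only [matrixN, Matrix.fromBlocks_apply₂₂, Matrix.diagonal_apply, Matrix.sub_apply]
      split_ifs <;> ring
  · rintro (v | v) (w | w)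
    · by_cases hv : v = e₁
      · simpa [matrixN, hv] using hcst 0
      · simp only [matrixN, Matrix.fromBlocks_apply₁₁, Matrix.of_apply, hv, if_false]
        exact ((hc.const_mul_left _).sub (hcst _)).add (hcst _)
    · by_cases hv : v = e₁
      · simpa only [matrixN, Matrix.fromBlocks_apply₁₂, Matrix.of_apply, hv, if_true] using hcst _
      · simp only [matrixN, Matrix.fromBlocks_apply₁₂, Matrix.of_apply, hv, if_false]
        exact hs.const_mul_left _
    · refine (hs.const_mul_left (if v = w then -1 else 0)).congr_left fun x => ?_
      simp only [matrixN, Matrix.fromBlocks_apply₂₁, Matrix.diagonal_apply]; split_ifs <;> ring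
    · refine ((hc.const_mul_left (if v = w then 1 else 0)).add
        (hcst (-parentMatrixHat G v₀ w v))).congr_left fun x => ?_
      simp only [matrixN, Matrix.fromBlocks_apply₂₂, Matrix.diagonal_apply, Matrix.sub_apply,
        Matrix.transpose_apply]
      split_ifs <;> ring

end Perturbation

theorem continuous_det_matrixN_const (e₁ : Edge v₀) {X : Type*} [TopologicalSpace X] {c s : X → ℂ}
    (hc : Continuous c) (hs : Continuous s) : Continuous fun x =>
      (matrixN G e₁ (fun _ => c x) (fun _ => s x) (fun _ => -s x) fun _ => c x).det := by
  refine Continuous.matrix_det (continuous_matrix ?_)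
  rintro (v | v) (w | w)
  · by_cases hv : v = e₁
    · simp only [matrixN, Matrix.fromBlocks_apply₁₁, Matrix.of_apply, hv, if_true]; fun_prop
    · simp only [matrixN, Matrix.fromBlocks_apply₁₁, Matrix.of_apply, hv, if_false]; fun_prop
  · by_cases hv : v = e₁
    · simp only [matrixN, Matrix.fromBlocks_apply₁₂, Matrix.of_apply, hv, if_true]; fun_prop
    · simp only [matrixN, Matrix.fromBlocks_apply₁₂, Matrix.of_apply, hv, if_false]; fun_prop
  · by_cases hv : v = w
    · simp only [matrixN, Matrix.fromBlocks_apply₂₁, Matrix.diagonal_apply, hv, if_true]; fun_prop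
    · simp only [matrixN, Matrix.fromBlocks_apply₂₁, Matrix.diagonal_apply, hv, if_false]; fun_prop
  · by_cases hv : v = w
    · simp only [matrixN, Matrix.fromBlocks_apply₂₂, Matrix.diagonal_apply, Matrix.sub_apply, hv,
        if_true]; fun_prop
    · simp only [matrixN, Matrix.fromBlocks_apply₂₂, Matrix.diagonal_apply, Matrix.sub_apply, hv,
        if_false]; fun_prop

theorem ofReal_cos_sq_add_sin_sq (t : ℝ) : (Real.cos t : ℂ) ^ 2 + (Real.sin t : ℂ) ^ 2 = 1 := by
  exact_mod_cast Real.cos_sq_add_sin_sq t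

/-- The determinant of Problem N for zero potentials; at the zeros of the sine both sides are `0`. -/
theorem div_sin_mul_psi_eq (hG : G.IsTree) (e₁ : Edge v₀) (he₁ : G.Adj v₀ e₁) (ρ : ℂ) (t : ℝ) :
    (ρ / Real.sin t : ℂ) * psi G (Real.cos t) = -(ρ * (matrixN G e₁ (fun _ => (Real.cos t : ℂ))
      (fun _ => (Real.sin t : ℂ)) (fun _ => -(Real.sin t : ℂ)) fun _ => (Real.cos t : ℂ)).det) := by
  by_cases hs : (Real.sin t : ℂ) = 0
  · rw [hs, det_matrixN_const_of_eq_zero]; simp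
  · rw [← neg_eq_iff_eq_neg.2 (mul_det_matrixN_const hG e₁ he₁ (ofReal_cos_sq_add_sin_sq t) hs)]
    field_simp

theorem isBigO_ofReal_one_of_abs_le {f : ℝ → ℝ} {l : Filter ℝ} (hf : ∀ x, |f x| ≤ 1) :
    (fun x => (f x : ℂ)) =O[l] fun _ => (1 : ℝ) :=
  IsBigO.of_bound 1 (Filter.Eventually.of_forall fun x => by simpa using hf x)

end RootedTree

theorem isBigO_endValues {ℓ : ℝ} (hℓ : 0 < ℓ) {q : ℝ → ℝ}
    (hq : MemLp q 2 (volume.restrict (Ioo 0 ℓ))) :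
    ((fun lam : ℝ => cEnd ℓ q lam - Real.cos (√lam * ℓ)) =O[Filter.atTop] fun lam => 1 / √lam) ∧
    ((fun lam : ℝ => √lam * sEnd ℓ q lam - Real.sin (√lam * ℓ))
      =O[Filter.atTop] fun lam => 1 / √lam) ∧
    ((fun lam : ℝ => cDerivEnd ℓ q lam / √lam - -(Real.sin (√lam * ℓ) : ℂ))
      =O[Filter.atTop] fun lam => 1 / √lam) ∧
    ((fun lam : ℝ => sDerivEnd ℓ q lam - Real.cos (√lam * ℓ))
      =O[Filter.atTop] fun lam => 1 / √lam) := by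
  obtain ⟨C, -, hC⟩ := exists_endValues_le hℓ hq
  have hev : ∀ᶠ lam : ℝ in Filter.atTop, C ≤ √lam ∧ 0 < lam :=
    (Real.tendsto_sqrt_atTop.eventually_ge_atTop C).and (Filter.eventually_gt_atTop 0)
  have hn : ∀ lam : ℝ, C / √lam = C * ‖1 / √lam‖ := fun lam => by
    rw [Real.norm_of_nonneg (by positivity)]; ring
  refine ⟨.of_bound C ?_, .of_bound C ?_, .of_bound C ?_, .of_bound C ?_⟩ <;>
    filter_upwards [hev] with lam hlam <;> rw [← hn]
  · exact (hC lam hlam.1 hlam.2).1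
  · exact (hC lam hlam.1 hlam.2).2.1
  · rw [sub_neg_eq_add]; exact (hC lam hlam.1 hlam.2).2.2.1
  · exact (hC lam hlam.1 hlam.2).2.2.2

theorem lemma3p7 {V : Type*} [Fintype V] [DecidableEq V] (G : SimpleGraph V) [DecidableRel G.Adj]
    (hG : G.IsTree) (v₀ : V) (e₁ : RootedTree.Edge v₀) (he₁ : G.Adj v₀ e₁) {n : ℕ}
    (rowsN rowsD cols : Fin n ≃ RootedTree.Edge v₀ ⊕ RootedTree.Edge v₀)
    (ℓ : ℝ) (hℓ : 0 < ℓ) (q : RootedTree.Edge v₀ → ℝ → ℝ)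
    (hq : ∀ e, MemLp (q e) 2 (volume.restrict (Ioo 0 ℓ))) :
    -- the quotient in the asymptotics of `φ_N` has removable singularities, with value zero
    (∀ lam : ℝ, 0 < lam → Real.sin (√lam * ℓ) = 0 →
      Filter.Tendsto
        (fun x : ℝ => (√x / Real.sin (√x * ℓ) : ℂ) * RootedTree.psi G (Real.cos (√x * ℓ)))
        (nhdsWithin lam {lam}ᶜ) (nhds 0)) ∧
    (fun lam : ℝ => RootedTree.phiN G e₁ rowsN cols ℓ q lam -
        (-(RootedTree.orderSign rowsN cols : ℤ) : ℂ) *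
          ((√lam / Real.sin (√lam * ℓ) : ℂ) * RootedTree.psi G (Real.cos (√lam * ℓ))))
      =O[Filter.atTop] (fun _ => (1 : ℝ)) ∧
    (fun lam : ℝ => RootedTree.phiD G rowsD cols ℓ q lam -
        ((-1) ^ G.degree v₀ * (RootedTree.orderSign rowsD cols : ℤ) : ℂ) *
          RootedTree.psiHat G v₀ (Real.cos (√lam * ℓ)))
      =O[Filter.atTop] (fun lam : ℝ => 1 / √lam) := by
  have hh : (fun lam : ℝ => 1 / √lam) =O[Filter.atTop] fun _ => (1 : ℝ) := by
    simp only [one_div]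
    exact (tendsto_inv_atTop_zero.comp Real.tendsto_sqrt_atTop).isBigO_one ℝ
  have hc : (fun lam : ℝ => (Real.cos (√lam * ℓ) : ℂ)) =O[Filter.atTop] fun _ => (1 : ℝ) :=
    RootedTree.isBigO_ofReal_one_of_abs_le fun x => Real.abs_cos_le_one _
  have hs : (fun lam : ℝ => (Real.sin (√lam * ℓ) : ℂ)) =O[Filter.atTop] fun _ => (1 : ℝ) :=
    RootedTree.isBigO_ofReal_one_of_abs_le fun x => Real.abs_sin_le_one _
  have hend := fun e => isBigO_endValues hℓ (hq e)
  have hne : ∀ᶠ lam : ℝ in Filter.atTop, ((√lam : ℝ) : ℂ) ≠ 0 := by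
    filter_upwards [Filter.eventually_gt_atTop 0] with lam hlam
    exact_mod_cast (Real.sqrt_pos.2 hlam).ne'
  refine ⟨fun lam _ hlam => ?_, ?_, ?_⟩
  · simp only [RootedTree.div_sin_mul_psi_eq hG e₁ he₁]
    have hcont := (Complex.continuous_ofReal.comp Real.continuous_sqrt).mul
      (RootedTree.continuous_det_matrixN_const (G := G) e₁
        (c := fun x : ℝ => (Real.cos (√x * ℓ) : ℂ)) (s := fun x : ℝ => (Real.sin (√x * ℓ) : ℂ))
        (by fun_prop) (by fun_prop)) |>.neg
    refine (hcont.tendsto' lam 0 ?_).mono_left nhdsWithin_le_nhds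
    simp only [Pi.neg_apply, Pi.mul_apply]
    rw [hlam, Complex.ofReal_zero, RootedTree.det_matrixN_const_of_eq_zero, mul_zero, neg_zero]
  · have hdet := RootedTree.isBigO_det_matrixN_sub (G := G) e₁ hh hc hs (fun e => (hend e).1)
      (fun e => (hend e).2.1) (fun e => (hend e).2.2.1) (fun e => (hend e).2.2.2)
    have hρ : (fun lam : ℝ => ((√lam : ℝ) : ℂ)) =O[Filter.atTop] fun lam : ℝ => √lam :=
      IsBigO.of_bound 1 (Filter.Eventually.of_forall fun x => by simp)
    have h1 := (hρ.mul hdet).const_mul_left ((RootedTree.orderSign rowsN cols : ℤ) : ℂ)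
    refine (h1.congr' ?_ Filter.EventuallyEq.rfl).trans ?_
    · filter_upwards [hne] with lam hlam
      rw [RootedTree.phiN, RootedTree.det_submatrix_eq, RootedTree.systemN_eq ℓ q _ hG,
        RootedTree.det_matrixN_scale e₁ (fun e => cEnd ℓ (q e) lam) (fun e => sEnd ℓ (q e) lam)
          (fun e => cDerivEnd ℓ (q e) lam) (fun e => sDerivEnd ℓ (q e) lam) hlam,
        RootedTree.div_sin_mul_psi_eq hG e₁ he₁]
      ring
    · refine IsBigO.of_bound 1 (Filter.Eventually.of_forall fun x => ?_)
      rw [mul_one_div, norm_one, mul_one, Real.norm_of_nonneg (by positivity)]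
      exact div_self_le_one _
  · have hdet := RootedTree.isBigO_det_matrixD_sub (G := G) hh hc hs (fun e => (hend e).1)
      (fun e => (hend e).2.1) (fun e => (hend e).2.2.1) (fun e => (hend e).2.2.2)
    refine (hdet.const_mul_left ((RootedTree.orderSign rowsD cols : ℤ) : ℂ)).congr' ?_
      Filter.EventuallyEq.rfl
    filter_upwards [hne] with lam hlam
    rw [RootedTree.phiD, RootedTree.det_submatrix_eq, RootedTree.systemD_eq ℓ q _ hG,
      RootedTree.det_matrixD_scale (fun e => cEnd ℓ (q e) lam) (fun e => sEnd ℓ (q e) lam)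
          (fun e => cDerivEnd ℓ (q e) lam) (fun e => sDerivEnd ℓ (q e) lam) hlam,
      RootedTree.det_matrixD_const hG (RootedTree.ofReal_cos_sq_add_sin_sq _)]
    ring
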